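/- **Setting.** Let $T\ge 1$ and let $\xi_0,\dots,\xi_T$ be random variables with values in a measurable space $\Xi$ (with measurable singletons) such that the law of $\boldsymbol\xi=(\xi_0,\dots,\xi_T)$ has finite support. Write $\boldsymbol\xi_{0:t}=(\xi_0,\dots,\xi_t)$. For $s\in\Xi$ let $A(s)\in\mathbb R^{n_x\times n_x}$, $B(s)\in\mathbb R^{n_x\times n_u}$, $d(s),q(s)\in\mathbb R^{n_x}$, $r(s)\in\mathbb R^{n_u}$, and let $Q(s)\in\mathbb R^{n_x\times n_x}$, $R(s)\in\mathbb R^{n_u\times n_u}$ be symmetric. For $w=[x;u]\in\mathbb R^{n_x}\times\mathbb R^{n_u}$ put $$f(w;s)=A(s)x+B(s)u+d(s),\qquad \ell(w;s)=\tfrac12\big(x^\top Q(s)x+u^\top R(s)u\big)-q(s)^\top x-r(s)^\top u,\qquad p(s)=[q(s);r(s);d(s)].$$ $\|\cdot\|$ is the Euclidean norm of vectors and the induced operator norm of matrices. Fix $\overline\xi_0$ with $\mathbb P[\xi_0=\overline\xi_0]>0$ and $\overline w_{-1}\in\mathbb R^{n_x}\times\mathbb R^{n_u}$. Let $\boldsymbol\Xi_{0:t}(\overline\xi_0)$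 be the set of values of $\boldsymbol\xi_{0:t}$ that have positive probability and whose first entry is $\overline\xi_0$. The full-horizon problem is to minimize $$\mathbb E\Big[\sum_{t=0}^T\ell\big(w_t(\boldsymbol\xi_{0:t});\xi_t\big)\,\Big|\,\xi_0=\overline\xi_0\Big]$$ over all functions $w_t=[x_t;u_t]:\boldsymbol\Xi_{0:t}(\overline\xi_0)\to\mathbb R^{n_x}\times\mathbb R^{n_u}$, $t=0,\dots,T$, such that $x_0(\overline\xi_0)=f(\overline w_{-1};\overline\xi_0)$ and $x_t(\overline{\boldsymbol\xi}_{0:t})=f(w_{t-1}(\overline{\boldsymbol\xi}_{0:t-1});\overline\xi_t)$ for all $1\le t\le T$ and all $\overline{\boldsymbol\xi}_{0:t}\in\boldsymbol\Xi_{0:t}(\overline\xi_0)$. **Assumptions.** Let $L\ge1$, $\alpha\in(0,1)$, $\gamma\in(0,1]$. Call random matrices $\Phi_t(\boldsymbol\xi_{0:t})$, $1\le t\le T$, *$(L,\alpha)$-stable* if $\|\Phi_{t''}(\boldsymbol\xi_{0:t''})\cdots\Phi_{t'+1}(\boldsymbol\xi_{0:t'+1})\|\le L\alpha^{t''-t'}$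 a.s. for all $0\le t'<t''\le T$. Suppose that, almost surely given $\xi_0=\overline\xi_0$: (a) $\|A(\xi_t)\|,\|B(\xi_t)\|,\|Q(\xi_t)\|,\|R(\xi_t)\|\le L$ for $0\le t\le T$; (b) $Q(\xi_t)\succeq0$ and $R(\xi_t)\succeq\gamma I$ for $0\le t\le T$; (c) (stabilizability) there are functions $K_t$ with $\|K_t(\boldsymbol\xi_{0:t})\|\le L$, $0\le t\le T-1$, for which the matrices $A(\xi_t)-B(\xi_t)K_{t-1}(\boldsymbol\xi_{0:t-1})$, $1\le t\le T$, are $(L,\alpha)$-stable; (d) (detectability) there are functions $K'_t$ with $\|K'_t(\boldsymbol\xi_{0:t})\|\le L$, $1\le t\le T$, for which the matrices $A(\xi_t)-K'_t(\boldsymbol\xi_{0:t})Q(\xi_{t-1})^{1/2}$, $1\le t\le T$, are $(L,\alpha)$-stable. **Constants.** $$L_H=2L+1,\quad \gamma_F=\frac{(1-\alpha)^2}{(1+L)^2L^2},\quad \gamma_G=\frac{\gamma(1-\alpha)^2}{2(1+L)^2L^4},\quad \overline\mu=\frac{2L_H^2/\gamma_G+\gamma_G+L_H}{\gamma_F},$$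 $$\gamma_H=\Big(\frac2{\gamma_G}+\Big(1+\frac{4L_H}{\gamma_G}+\frac{4L_H^2}{\gamma_G^2}\Big)\frac{L_H(1+\overline\mu L_H)}{\gamma_F}+\overline\mu\Big)^{-1},\quad \rho=\Big(\frac{L_H^2-\gamma_H^2}{L_H^2+\gamma_H^2}\Big)^{1/2},\quad c_1=\frac{L_H}{\gamma_H^2\rho}.$$ **Claim.** $0<\rho<1$; the full-horizon problem has a unique solution $\{w^\star_t\}_{t=0}^T$; for all $0\le t\le T$, $$\Big\{\mathbb E\big[\|w^\star_t(\boldsymbol\xi_{0:t})\|^2\,\big|\,\xi_0=\overline\xi_0\big]\Big\}^{1/2}\le c_1\Big(2L\rho^t\|\overline w_{-1}\|+\sum_{t'=0}^T\rho^{|t-t'|}\big\{\mathbb E\big[\|p(\xi_{t'})\|^2\,\big|\,\xi_0=\overline\xi_0\big]\big\}^{1/2}\Big);$$ and the optimal policy is exponentially input-to-state stable in expectation: with $D=\max_{0\le t\le T}\{\mathbb E[\|p(\xi_t)\|^2\mid\xi_0=\overline\xi_0]\}^{1/2}$, for all $0\le t\le T$, $$\Big\{\mathbb E\big[\|w^\star_t(\boldsymbol\xi_{0:t})\|^2\,\big|\,\xi_0=\overline\xi_0\big]\Big\}^{1/2}\le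 c_1\Big(2L\rho^t\|\overline w_{-1}\|+\frac2{1-\rho}D\Big).$$ -/

import Mathlib

open MeasureTheory ProbabilityTheory
open scoped Matrix.Norms.L2Operator MatrixOrder

/-! Norms: on vectors, the Euclidean norm; on matrices, the norm from the scope
`Matrix.Norms.L2Operator`, that is, the operator norm induced by the Euclidean norms. -/

noncomputable section

namespace StochLQ

/-- `ℝⁿ` with the Euclidean norm. -/
abbrev Vec (n : ℕ) : Type := EuclideanSpace ℝ (Fin n)

/-- State-control pairs `w = [x; u]`, with the Euclidean norm of the stacked vector. -/
abbrev StateControl (nx nu : ℕ) : Type := WithLp 2 (Vec nx × Vec nu)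

/-- The data of a linear-quadratic problem with additive and multiplicative uncertainty, as
functions of the value of the uncertainty at one stage. -/
structure LQData (Ξ : Type*) (nx nu : ℕ) where
  A : Ξ → Matrix (Fin nx) (Fin nx) ℝ
  B : Ξ → Matrix (Fin nx) (Fin nu) ℝ
  d : Ξ → Vec nx
  Q : Ξ → Matrix (Fin nx) (Fin nx) ℝ
  R : Ξ → Matrix (Fin nu) (Fin nu) ℝ
  q : Ξ → Vec nx
  r : Ξ → Vec nu
  isSymm_Q : ∀ s, (Q s).IsSymm
  isSymm_R : ∀ s, (R s).IsSymm

namespace LQData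

variable {Ξ : Type*} {nx nu : ℕ}

/-- The dynamics `f(w; s) = A(s) x + B(s) u + d(s)`. -/
def f (D : LQData Ξ nx nu) (w : StateControl nx nu) (s : Ξ) : Vec nx :=
  Matrix.toEuclideanLin (D.A s) w.fst + Matrix.toEuclideanLin (D.B s) w.snd + D.d s

/-- The stage cost
`ℓ(w; s) = 1/2 (xᵀ Q(s) x + uᵀ R(s) u) - (q(s)ᵀ x + r(s)ᵀ u)`. -/
def stageCost (D : LQData Ξ nx nu) (w : StateControl nx nu) (s : Ξ) : ℝ :=
  (1 / 2) * (inner ℝ w.fst (Matrix.toEuclideanLin (D.Q s) w.fst)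
    + inner ℝ w.snd (Matrix.toEuclideanLin (D.R s) w.snd))
    - (inner ℝ (D.q s) w.fst + inner ℝ (D.r s) w.snd)

/-- The stacked additive uncertainty `p(s) = [q(s); r(s); d(s)]`, with the Euclidean norm. -/
def p (D : LQData Ξ nx nu) (s : Ξ) : WithLp 2 (Vec nx × WithLp 2 (Vec nu × Vec nx)) :=
  WithLp.toLp 2 (D.q s, WithLp.toLp 2 (D.r s, D.d s))

end LQData

/-! ### The uncertainty process -/

/-- A possible value `(s₀, …, s_t)` of the observations up to and including stage `t`. -/
abbrev Hist (Ξ : Type*) {T : ℕ} (t : Fin (T + 1)) : Type _ := Finset.Iic t → Ξ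

section Uncertainty

variable {Ω Ξ : Type*} {T : ℕ}

/-- The observed history `ξ_{0:t}`. -/
def hist (ξ : Fin (T + 1) → Ω → Ξ) (t : Fin (T + 1)) (ω : Ω) : Hist Ξ t :=
  fun s => ξ s ω

variable [MeasurableSpace Ω]

/-- The law of the process `(ξ_0, …, ξ_T)` has finite support. -/
def HasFiniteSupport (P : Measure Ω) (ξ : Fin (T + 1) → Ω → Ξ) : Prop :=
  ∃ S : Set (Fin (T + 1) → Ξ), S.Finite ∧ ∀ᵐ ω ∂P, (fun t => ξ t ω) ∈ S

/-- The set `Ξ_{0:t}(s₀)` of the values of `ξ_{0:t}` that have positive probability and start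
with `s₀`. -/
def histSupport (P : Measure Ω) (ξ : Fin (T + 1) → Ω → Ξ) (s₀ : Ξ) (t : Fin (T + 1)) :
    Set (Hist Ξ t) :=
  {h | P (hist ξ t ⁻¹' {h}) ≠ 0 ∧ h ⟨0, Finset.mem_Iic.2 (Fin.zero_le t)⟩ = s₀}

/-- The conditional probability given `ξ_0 = s₀`. -/
def condLaw (P : Measure Ω) (ξ : Fin (T + 1) → Ω → Ξ) (s₀ : Ξ) : Measure Ω :=
  ProbabilityTheory.cond P (ξ 0 ⁻¹' {s₀})

end Uncertainty

/-! ### Stability, stabilizability and detectability -/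

/-- The ordered product `Ψ_b ⋯ Ψ_{a+1}` (the identity if `b ≤ a`). A sequence indexed by the
stages `1, …, T` is indexed here by `Fin T`, the index `t` standing for the stage `t.succ`. -/
def transition {T n : ℕ} (Ψ : Fin T → Matrix (Fin n) (Fin n) ℝ) (a b : Fin (T + 1)) :
    Matrix (Fin n) (Fin n) ℝ :=
  Fin.induction (motive := fun _ => Matrix (Fin n) (Fin n) ℝ) 1
    (fun t M => if a ≤ t.castSucc then Ψ t * M else 1) b

section Stability

variable {Ω Ξ : Type*} [MeasurableSpace Ω] {T nx nu m : ℕ}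

/-- `(L, α)`-stability, almost surely under `μ`, of random matrices `Φ_t(ξ_{0:t})`,
`t = 1, …, T`. -/
def IsStable (μ : Measure Ω) (ξ : Fin (T + 1) → Ω → Ξ) (L α : ℝ)
    (Φ : (t : Fin T) → Hist Ξ t.succ → Matrix (Fin nx) (Fin nx) ℝ) : Prop :=
  ∀ a b : Fin (T + 1), a < b → ∀ᵐ ω ∂μ,
    ‖transition (fun t => Φ t (hist ξ t.succ ω)) a b‖ ≤ L * α ^ ((b : ℕ) - (a : ℕ))

/-- The part `ξ_{0:t-1}` of a history `ξ_{0:t}`. -/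
def Hist.init {t : Fin T} (h : Hist Ξ t.succ) : Hist Ξ t.castSucc :=
  fun s => h ⟨s, Finset.mem_Iic.2 ((Finset.mem_Iic.1 s.2).trans (Fin.castSucc_lt_succ).le)⟩

/-- The current value `ξ_t` in a history `ξ_{0:t}`. -/
def Hist.last {t : Fin (T + 1)} (h : Hist Ξ t) : Ξ := h ⟨t, Finset.mem_Iic.2 le_rfl⟩

/-- `(L, α)`-stabilizability: there are nonanticipative gains `K_t(ξ_{0:t})`,
`t = 0, …, T - 1`, bounded by `L`, for which the matrices
`A(ξ_t) - B(ξ_t) K_{t-1}(ξ_{0:t-1})`, `t = 1, …, T`, are `(L, α)`-stable. -/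
def IsStabilizable (μ : Measure Ω) (ξ : Fin (T + 1) → Ω → Ξ) (L α : ℝ)
    (A : Ξ → Matrix (Fin nx) (Fin nx) ℝ) (B : Ξ → Matrix (Fin nx) (Fin nu) ℝ) : Prop :=
  ∃ K : (t : Fin T) → Hist Ξ t.castSucc → Matrix (Fin nu) (Fin nx) ℝ,
    (∀ t, ∀ᵐ ω ∂μ, ‖K t (hist ξ t.castSucc ω)‖ ≤ L) ∧
    IsStable μ ξ L α (fun t h => A h.last - B h.last * K t h.init)

/-- `(L, α)`-detectability: there are nonanticipative gains `K_t(ξ_{0:t})`,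
`t = 1, …, T`, bounded by `L`, for which the matrices
`A(ξ_t) - K_t(ξ_{0:t}) C(ξ_{t-1})`, `t = 1, …, T`, are `(L, α)`-stable. -/
def IsDetectable (μ : Measure Ω) (ξ : Fin (T + 1) → Ω → Ξ) (L α : ℝ)
    (A : Ξ → Matrix (Fin nx) (Fin nx) ℝ) (C : Ξ → Matrix (Fin m) (Fin nx) ℝ) : Prop :=
  ∃ K : (t : Fin T) → Hist Ξ t.succ → Matrix (Fin nx) (Fin m) ℝ,
    (∀ t, ∀ᵐ ω ∂μ, ‖K t (hist ξ t.succ ω)‖ ≤ L) ∧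
    IsStable μ ξ L α (fun t h => A h.last - K t h * C h.init.last)

/-- The standing assumptions on the system, with constants `L`, `α`, `γ`, almost surely
under `μ`. -/
structure SystemAssumption (μ : Measure Ω) (ξ : Fin (T + 1) → Ω → Ξ) (D : LQData Ξ nx nu)
    (L α γ : ℝ) : Prop where
  bounded : ∀ t, ∀ᵐ ω ∂μ, ‖D.A (ξ t ω)‖ ≤ L ∧ ‖D.B (ξ t ω)‖ ≤ L ∧
    ‖D.Q (ξ t ω)‖ ≤ L ∧ ‖D.R (ξ t ω)‖ ≤ L
  posSemidef_Q : ∀ t, ∀ᵐ ω ∂μ, (D.Q (ξ t ω)).PosSemidef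
  posDef_R : ∀ t, ∀ᵐ ω ∂μ,
    (D.R (ξ t ω) - γ • (1 : Matrix (Fin nu) (Fin nu) ℝ)).PosSemidef
  stabilizable : IsStabilizable μ ξ L α D.A D.B
  detectable : IsDetectable μ ξ L α D.A (fun s => CFC.sqrt (D.Q s))

end Stability

/-! ### The stochastic optimal control problem -/

section Problem

variable {Ω Ξ : Type*} [MeasurableSpace Ω] {T nx nu : ℕ}

/-- Decision processes `w_t : Ξ_{0:t}(s₀) → ℝ^{nx} × ℝ^{nu}`, `t = 0, …, T`. -/
abbrev Policy (P : Measure Ω) (ξ : Fin (T + 1) → Ω → Ξ) (s₀ : Ξ) (nx nu : ℕ) : Type _ :=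
  (t : Fin (T + 1)) → histSupport P ξ s₀ t → StateControl nx nu

variable {P : Measure Ω} {ξ : Fin (T + 1) → Ω → Ξ} {s₀ : Ξ}

/-- The value `w_t(h)`. Outside of `Ξ_{0:t}(s₀)` it is `0`; if the law of the process has finite
support, then `ξ_{0:t}` lies in `Ξ_{0:t}(s₀)` almost surely given `ξ_0 = s₀`. -/
def Policy.eval (w : Policy P ξ s₀ nx nu) (t : Fin (T + 1)) (h : Hist Ξ t) :
    StateControl nx nu :=
  Function.extend Subtype.val (w t) 0 h

/-- The constraints: `x_0 = f(w_{-1}; ξ_0)` and `x_t(ξ_{0:t}) = f(w_{t-1}(ξ_{0:t-1}); ξ_t)` for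
all `t = 1, …, T` and all histories in `Ξ_{0:t}(s₀)`. -/
structure Policy.IsFeasible (D : LQData Ξ nx nu) (wInit : StateControl nx nu)
    (w : Policy P ξ s₀ nx nu) : Prop where
  initial : ∀ h : histSupport P ξ s₀ 0, (w 0 h).fst = D.f wInit s₀
  step : ∀ (t : Fin T) (h : histSupport P ξ s₀ t.succ),
    (w t.succ h).fst = D.f (w.eval t.castSucc h.1.init) h.1.last

/-- The expected cost `E[∑ₜ ℓ(w_t(ξ_{0:t}); ξ_t) | ξ_0 = s₀]`. -/
def Policy.cost (D : LQData Ξ nx nu) (w : Policy P ξ s₀ nx nu) : ℝ :=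
  ∫ ω, ∑ t, D.stageCost (w.eval t (hist ξ t ω)) (ξ t ω) ∂(condLaw P ξ s₀)

/-- `w` is an optimal policy: it is feasible and minimizes the expected cost over all feasible
policies. -/
def Policy.IsOptimal (D : LQData Ξ nx nu) (wInit : StateControl nx nu)
    (w : Policy P ξ s₀ nx nu) : Prop :=
  w.IsFeasible D wInit ∧
    ∀ w' : Policy P ξ s₀ nx nu, w'.IsFeasible D wInit → w.cost D ≤ w'.cost D

/-- `(E[‖w_t(ξ_{0:t})‖² | ξ_0 = s₀])^{1/2}`. -/
def Policy.rms (w : Policy P ξ s₀ nx nu) (t : Fin (T + 1)) : ℝ :=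
  Real.sqrt (∫ ω, ‖w.eval t (hist ξ t ω)‖ ^ 2 ∂(condLaw P ξ s₀))

/-- `(E[‖p(ξ_t)‖² | ξ_0 = s₀])^{1/2}`. -/
def rmsP (P : Measure Ω) (ξ : Fin (T + 1) → Ω → Ξ) (s₀ : Ξ) (D : LQData Ξ nx nu)
    (t : Fin (T + 1)) : ℝ :=
  Real.sqrt (∫ ω, ‖D.p (ξ t ω)‖ ^ 2 ∂(condLaw P ξ s₀))

/-- The maximum over `t = 0, …, T` of `(E[‖p(ξ_t)‖² | ξ_0 = s₀])^{1/2}`. -/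
def maxRmsP (P : Measure Ω) (ξ : Fin (T + 1) → Ω → Ξ) (s₀ : Ξ) (D : LQData Ξ nx nu) : ℝ :=
  Finset.univ.sup' Finset.univ_nonempty (rmsP P ξ s₀ D)

end Problem

/-! ### The constants -/

def constLH (L : ℝ) : ℝ := 2 * L + 1

def constγF (L α : ℝ) : ℝ := (1 - α) ^ 2 / ((1 + L) ^ 2 * L ^ 2)

def constγG (L α γ : ℝ) : ℝ := γ * (1 - α) ^ 2 / (2 * (1 + L) ^ 2 * L ^ 4)

def constμ (L α γ : ℝ) : ℝ :=
  (2 * constLH L ^ 2 / constγG L α γ + constγG L α γ + constLH L) / constγF L α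

def constγH (L α γ : ℝ) : ℝ :=
  (2 / constγG L α γ
    + (1 + 4 * constLH L / constγG L α γ + 4 * constLH L ^ 2 / constγG L α γ ^ 2)
      * (constLH L * (1 + constμ L α γ * constLH L) / constγF L α)
    + constμ L α γ)⁻¹

/-- The decay rate `ρ`. -/
def rate (L α γ : ℝ) : ℝ :=
  Real.sqrt ((constLH L ^ 2 - constγH L α γ ^ 2) / (constLH L ^ 2 + constγH L α γ ^ 2))

/-- The constant `c₁`. -/
def constC (L α γ : ℝ) : ℝ := constLH L / (constγH L α γ ^ 2 * rate L α γ)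

end StochLQ

end

/-! Because the law has finite support, conditioning on the initial value turns the problem into an
equality-constrained quadratic program on a finite-dimensional Hilbert space. Its elements are the
processes on the tree of histories, with inner product the expectation of the stagewise inner
products. If `G` is the Hessian and `F` the linear part of the dynamics, optimality amounts to the
saddle point system `F w = b`, `G w + F* μ = a`.

The system assumptions enter through three facts, collected in `IsSaddle`. `G` is bounded by `L`.
Stabilizability gives `F` a right inverse bounded by `σ`, via the closed loop
(`Assumption.exists_rightInverse`). Detectability makes `G` coercive on the kernel of `F`, via an
output injection (`Assumption.coercive`). These give a solution (`IsSaddle.exists_solution`) and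
quadratic growth of the cost around it (`IsSaddle.cost_gap`), hence a unique minimizer.

Decay comes from conjugation with exponential weights. Fix a stage `t` and multiply stage `t'` by `ρ
^ |t - t'|`. This commutes with `G`, which acts stage by stage, and nearly commutes with `F`, which
couples only neighbouring stages: the commutator has size `(ρ⁻¹ - 1) * 2L`. The weighted solution
therefore solves the weighted system up to an error small enough to be absorbed
(`IsSaddle.weighted_bound`). The weight is `1` at stage `t`, so the bound on the weighted norm
controls stage `t` by exponentially discounted data (`Assumption.rms_le`).

The constants `γ_H`, `ρ` and `c₁` enter the decay estimate only through `saddle_const_le`,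
`weight_defect_le` and `four_mul_inv_le_constC`, together with positivity and `0 < ρ < 1`. -/

namespace StochLQ

/-! ### Saddle point systems in inner product spaces -/

section SaddlePoint

open scoped InnerProductSpace

variable {E Λ : Type*} [NormedAddCommGroup E] [InnerProductSpace ℝ E]
  [NormedAddCommGroup Λ] [InnerProductSpace ℝ Λ]

/-- A quadratic form `G` that is bounded by `L` and `g`-coercive on the kernel of a linear map `F`
with a right inverse bounded by `σ`. -/
structure IsSaddle (G : E →ₗ[ℝ] E) (F : E →ₗ[ℝ] Λ) (L σ g : ℝ) : Prop where
  bound : ∀ v, ‖G v‖ ≤ L * ‖v‖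
  rightInv : ∀ c, ∃ y, F y = c ∧ ‖y‖ ≤ σ * ‖c‖
  coercive : ∀ v, F v = 0 → g * ‖v‖ ^ 2 ≤ ⟪G v, v⟫_ℝ

variable {G : E →ₗ[ℝ] E} {F : E →ₗ[ℝ] Λ} {L σ g : ℝ}

/-- Subtracting a bounded preimage `y` of `F w` leaves `w - y` in the kernel of `F`. Testing with `w
- y` removes the multiplier, and coercivity applies. Only an upper bound on the residual functional
is needed, so the estimate also covers perturbed systems. -/
theorem IsSaddle.primal_bound (h : IsSaddle G F L σ g) (hL : 0 ≤ L) (hg : 0 < g)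
    {w : E} {μ : Λ} {a : ℝ} (ha : 0 ≤ a) (hσ : 0 ≤ σ)
    (hw : ∀ v, ⟪G w, v⟫_ℝ + ⟪μ, F v⟫_ℝ ≤ a * ‖v‖) :
    ‖w‖ ≤ (a + L * σ * ‖F w‖) / g + σ * ‖F w‖ := by
  obtain ⟨y, hy, hyn⟩ := h.rightInv (F w)
  have hn : F (w - y) = 0 := by rw [map_sub, hy, sub_self]
  have h1 := h.coercive _ hn
  have h2 := hw (w - y)
  rw [hn, inner_zero_right, add_zero] at h2
  have h3 : ⟪G (w - y), w - y⟫_ℝ = ⟪G w, w - y⟫_ℝ - ⟪G y, w - y⟫_ℝ := by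
    rw [map_sub, inner_sub_left]
  have h4 : -⟪G y, w - y⟫_ℝ ≤ L * σ * ‖F w‖ * ‖w - y‖ := by
    have := (abs_le.1 (abs_real_inner_le_norm (G y) (w - y))).1
    have h5 : ‖G y‖ ≤ L * σ * ‖F w‖ := by
      have := mul_le_mul_of_nonneg_left hyn hL
      linarith [h.bound y]
    have := mul_le_mul_of_nonneg_right h5 (norm_nonneg (w - y))
    linarith
  have h6 : g * ‖w - y‖ ^ 2 ≤ (a + L * σ * ‖F w‖) * ‖w - y‖ := by
    rw [h3] at h1; linarith
  have h7 : ‖w - y‖ ≤ (a + L * σ * ‖F w‖) / g := by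
    rw [le_div_iff₀ hg]
    rcases (norm_nonneg (w - y)).eq_or_lt with h0 | h0
    · rw [← h0, zero_mul]; positivity
    · refine le_of_mul_le_mul_right ?_ h0
      linarith
  calc ‖w‖ = ‖(w - y) + y‖ := by rw [sub_add_cancel]
    _ ≤ ‖w - y‖ + ‖y‖ := norm_add_le _ _
    _ ≤ _ := add_le_add h7 hyn

/-- Testing with a bounded preimage of `μ` under `F` produces `‖μ‖ ^ 2`. -/
theorem IsSaddle.dual_bound (h : IsSaddle G F L σ g) (hL : 0 ≤ L) (hσ : 0 ≤ σ)
    {w : E} {μ : Λ} {a : ℝ} (ha : 0 ≤ a)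
    (hw : ∀ v, ⟪G w, v⟫_ℝ + ⟪μ, F v⟫_ℝ ≤ a * ‖v‖) :
    ‖μ‖ ≤ σ * (a + L * ‖w‖) := by
  obtain ⟨y, hy, hyn⟩ := h.rightInv μ
  have h2 := hw y
  rw [hy, real_inner_self_eq_norm_sq] at h2
  have h3 := (abs_le.1 (abs_real_inner_le_norm (G w) y)).1
  have h4 := mul_le_mul_of_nonneg_right (h.bound w) (norm_nonneg y)
  have h5 : (a + L * ‖w‖) * ‖y‖ ≤ (a + L * ‖w‖) * (σ * ‖μ‖) :=
    mul_le_mul_of_nonneg_left hyn (by positivity)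
  rcases (norm_nonneg μ).eq_or_lt with h0 | h0
  · rw [← h0]; positivity
  · refine le_of_mul_le_mul_right ?_ h0
    nlinarith

/-- If `F` nearly commutes with the weights `D` and `D'`, then the weighted solution of a saddle
point system is bounded by the weighted data. -/
theorem IsSaddle.weighted_bound (h : IsSaddle G F L σ g) (hL : 1 ≤ L) (hσ : 1 ≤ σ) (hg : 0 < g)
    {D : E →ₗ[ℝ] E} {D' : Λ →ₗ[ℝ] Λ} {ε K : ℝ} (hε : 0 ≤ ε)
    (hD : D.IsSymmetric) (hD' : D'.IsSymmetric) (hGD : ∀ v, G (D v) = D (G v))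
    (hFD : ∀ v, ‖F (D v) - D' (F v)‖ ≤ ε * ‖D v‖)
    (hFD' : ∀ v, ∃ e, F (D v) - D' (F v) = D' e ∧ ‖e‖ ≤ ε * ‖v‖)
    (hK : (1 + L * σ) * (L * σ / g + σ) + σ ≤ K) (hKε : K * ε ≤ 1 / 2)
    {w a : E} {μ b : Λ} (hw : F w = b) (hμ : ∀ v, ⟪G w, v⟫_ℝ + ⟪μ, F v⟫_ℝ = ⟪a, v⟫_ℝ) :
    ‖D w‖ ≤ 2 * K * (‖D a‖ + ‖D' b‖) := by
  -- Test the multiplier equation with `D v` and move `D` to the other side. Writing the commutator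
  -- as `D' e` lets the symmetric `D'` fall on `μ`, so the error involves only the weighted
  -- multiplier.
  have hres : ∀ v, ⟪G (D w), v⟫_ℝ + ⟪D' μ, F v⟫_ℝ ≤ (‖D a‖ + ε * ‖D' μ‖) * ‖v‖ := by
    intro v
    obtain ⟨e, he, hen⟩ := hFD' v
    have h1 : ⟪G (D w), v⟫_ℝ = ⟪G w, D v⟫_ℝ := by rw [hGD, hD]
    have h2 : ⟪D' μ, F v⟫_ℝ = ⟪μ, F (D v)⟫_ℝ - ⟪D' μ, e⟫_ℝ := by
      rw [hD', hD' μ e, ← he, inner_sub_right]; ring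
    have h3 : ⟪a, D v⟫_ℝ = ⟪D a, v⟫_ℝ := (hD a v).symm
    have h4 := hμ (D v)
    have h5 := real_inner_le_norm (D a) v
    have h6 := (abs_le.1 (abs_real_inner_le_norm (D' μ) e)).1
    have h7 := mul_le_mul_of_nonneg_left hen (norm_nonneg (D' μ))
    rw [h1, h2]
    nlinarith
  have ha : 0 ≤ ‖D a‖ + ε * ‖D' μ‖ := by positivity
  have hp := h.primal_bound (by linarith) hg ha (by linarith) hres
  have hd := h.dual_bound (by linarith) (by linarith) ha hres
  have hF : ‖F (D w)‖ ≤ ‖D' b‖ + ε * ‖D w‖ := by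
    calc ‖F (D w)‖ = ‖D' b + (F (D w) - D' (F w))‖ := by rw [hw]; congr 1; abel
      _ ≤ _ := (norm_add_le _ _).trans (add_le_add le_rfl (hFD w))
  set A := ‖D a‖ + ε * ‖D' μ‖
  set B := ‖F (D w)‖
  set W := ‖D w‖
  set M := ‖D' μ‖
  have hB : 0 ≤ B := norm_nonneg _
  have hW : 0 ≤ W := norm_nonneg _
  have hM : 0 ≤ M := norm_nonneg _
  have hLσ : 1 ≤ L * σ := one_le_mul_of_one_le_of_one_le hL hσ
  have hp' : W ≤ (L * σ / g + σ) * (A + B) := by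
    have : (A + L * σ * B) / g ≤ (L * σ / g) * (A + B) := by
      rw [div_mul_eq_mul_div]
      gcongr
      nlinarith
    nlinarith
  -- Inserting the primal bound into the dual one produces exactly the constant in `hK`.
  have hsum : W + M ≤ K * (A + B) := by
    have h1 : W + M ≤ (1 + L * σ) * W + σ * A := by nlinarith
    have h2 : (1 + L * σ) * W ≤ (1 + L * σ) * ((L * σ / g + σ) * (A + B)) :=
      mul_le_mul_of_nonneg_left hp' (by linarith)
    have h3 : ((1 + L * σ) * (L * σ / g + σ) + σ) * (A + B) ≤ K * (A + B) :=
      mul_le_mul_of_nonneg_right hK (by linarith)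
    nlinarith
  have hK0 : 0 ≤ K := by
    refine le_trans ?_ hK
    positivity
  -- The unknowns return on the right with factor `K * ε ≤ 1 / 2` and are absorbed.
  have h8 : K * (A + B) ≤ K * (‖D a‖ + ‖D' b‖) + K * ε * (W + M) := by
    have : A + B ≤ (‖D a‖ + ‖D' b‖) + ε * (W + M) := by
      simp only [A]; linarith
    have := mul_le_mul_of_nonneg_left this hK0
    linarith
  have h9 : K * ε * (W + M) ≤ 1 / 2 * (W + M) := mul_le_mul_of_nonneg_right hKε (by linarith)
  linarith

/-- The saddle point operator is an endomorphism of a finite-dimensional space. The two a priori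
bounds with zero data make it injective, hence surjective. -/
theorem IsSaddle.exists_solution [FiniteDimensional ℝ E] [FiniteDimensional ℝ Λ]
    (h : IsSaddle G F L σ g) (hL : 0 ≤ L) (hσ : 0 ≤ σ) (hg : 0 < g) (a : E) (b : Λ) :
    ∃ w μ, F w = b ∧ ∀ v, ⟪G w, v⟫_ℝ + ⟪μ, F v⟫_ℝ = ⟪a, v⟫_ℝ := by
  let M : (E × Λ) →ₗ[ℝ] (E × Λ) :=
    (G.comp (LinearMap.fst ℝ E Λ) + (LinearMap.adjoint F).comp (LinearMap.snd ℝ E Λ)).prod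
      (F.comp (LinearMap.fst ℝ E Λ))
  have hM : ∀ w μ v, ⟪(M (w, μ)).1, v⟫_ℝ = ⟪G w, v⟫_ℝ + ⟪μ, F v⟫_ℝ := by
    intro w μ v
    simp [M, inner_add_left, LinearMap.adjoint_inner_left]
  have hM2 : ∀ w μ, (M (w, μ)).2 = F w := fun _ _ => rfl
  have hinj : Function.Injective M := by
    rw [injective_iff_map_eq_zero]
    rintro ⟨w, μ⟩ h0
    have hr : ∀ v, ⟪G w, v⟫_ℝ + ⟪μ, F v⟫_ℝ ≤ 0 * ‖v‖ := by
      intro v; rw [← hM, h0]; simp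
    have hFw : F w = 0 := by rw [← hM2 w μ, h0]; rfl
    have hw : ‖w‖ = 0 := by
      have := h.primal_bound hL hg le_rfl hσ hr
      rw [hFw] at this
      simp only [norm_zero, mul_zero, add_zero, zero_div] at this
      exact le_antisymm this (norm_nonneg _)
    have hμ : ‖μ‖ = 0 := by
      have := h.dual_bound hL hσ le_rfl hr
      rw [hw] at this
      simp only [mul_zero, add_zero] at this
      exact le_antisymm this (norm_nonneg _)
    rw [norm_eq_zero] at hw hμ
    rw [hw, hμ]; rfl
  obtain ⟨⟨w, μ⟩, hwμ⟩ := LinearMap.injective_iff_surjective.1 hinj (a, b)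
  refine ⟨w, μ, by rw [← hM2 w μ, hwμ], fun v => ?_⟩
  rw [← hM, hwμ]

/-- The difference of two points with the same `F` lies in the kernel of `F`. There the multiplier
equation cancels the first-order term, and coercivity bounds the second-order term from below. -/
theorem IsSaddle.cost_gap (h : IsSaddle G F L σ g) (hG : G.IsSymmetric)
    {w w' a : E} {μ : Λ} (hww : F w' = F w)
    (hμ : ∀ v, ⟪G w, v⟫_ℝ + ⟪μ, F v⟫_ℝ = ⟪a, v⟫_ℝ) :
    1 / 2 * ⟪G w, w⟫_ℝ - ⟪a, w⟫_ℝ + g / 2 * ‖w' - w‖ ^ 2 ≤ 1 / 2 * ⟪G w', w'⟫_ℝ - ⟪a, w'⟫_ℝ := by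
  have hn : F (w' - w) = 0 := by rw [map_sub, hww, sub_self]
  have h1 := h.coercive _ hn
  have h2 := hμ (w' - w)
  rw [hn, inner_zero_right, add_zero] at h2
  have h3 : ⟪G w', w⟫_ℝ = ⟪G w, w'⟫_ℝ := by rw [hG, real_inner_comm]
  simp only [map_sub, inner_sub_left, inner_sub_right] at h1 h2
  linarith

end SaddlePoint

end StochLQ

namespace StochLQ

/-! ### Stable linear recursions along one scenario -/

section Recursion

variable {T n : ℕ}

theorem norm_toEuclideanLin_le {m : ℕ} (M : Matrix (Fin m) (Fin n) ℝ) (v : Vec n) :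
    ‖Matrix.toEuclideanLin M v‖ ≤ ‖M‖ * ‖v‖ :=
  Matrix.l2_opNorm_mulVec M v

theorem transition_self (Ψ : Fin T → Matrix (Fin n) (Fin n) ℝ) (a : Fin (T + 1)) :
    transition Ψ a a = 1 := by
  cases a using Fin.cases with
  | zero => rfl
  | succ t =>
    rw [transition, Fin.induction_succ, if_neg]
    exact not_le.2 Fin.castSucc_lt_succ

theorem transition_succ (Ψ : Fin T → Matrix (Fin n) (Fin n) ℝ) {a : Fin (T + 1)} {t : Fin T}
    (h : a ≤ t.castSucc) : transition Ψ a t.succ = Ψ t * transition Ψ a t.castSucc := by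
  rw [transition, Fin.induction_succ, if_pos h]; rfl

theorem eq_sum_transition (Ψ : Fin T → Matrix (Fin n) (Fin n) ℝ) {x c : Fin (T + 1) → Vec n}
    (h0 : x 0 = c 0)
    (hx : ∀ t : Fin T, x t.succ = Matrix.toEuclideanLin (Ψ t) (x t.castSucc) + c t.succ)
    (b : Fin (T + 1)) :
    x b = ∑ a ∈ Finset.Iic b, Matrix.toEuclideanLin (transition Ψ a b) (c a) := by
  induction b using Fin.induction with
  | zero =>
    have : Finset.Iic (0 : Fin (T + 1)) = {0} := by
      ext a; simp
    rw [this, Finset.sum_singleton, transition_self, h0]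
    simp
  | succ t ih =>
    have : Finset.Iic t.succ = insert t.succ (Finset.Iic t.castSucc) := by
      ext a
      simp only [Finset.mem_Iic, Finset.mem_insert, Fin.le_def, Fin.ext_iff, Fin.val_succ,
        Fin.val_castSucc]
      omega
    rw [this, Finset.sum_insert (by simp), transition_self, hx, ih, map_sum, add_comm]
    congr 1
    · simp
    · refine Finset.sum_congr rfl fun a ha => ?_
      rw [transition_succ Ψ (Finset.mem_Iic.1 ha)]
      simp [Matrix.toLpLin_mul_same]

theorem norm_le_sum_pow {L α : ℝ} (hL : 1 ≤ L) (Ψ : Fin T → Matrix (Fin n) (Fin n) ℝ)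
    (hΨ : ∀ a b : Fin (T + 1), a < b → ‖transition Ψ a b‖ ≤ L * α ^ ((b : ℕ) - (a : ℕ)))
    {x c : Fin (T + 1) → Vec n} (h0 : x 0 = c 0)
    (hx : ∀ t : Fin T, x t.succ = Matrix.toEuclideanLin (Ψ t) (x t.castSucc) + c t.succ)
    (b : Fin (T + 1)) :
    ‖x b‖ ≤ L * ∑ a ∈ Finset.Iic b, α ^ ((b : ℕ) - (a : ℕ)) * ‖c a‖ := by
  rw [eq_sum_transition Ψ h0 hx b, Finset.mul_sum]
  refine (norm_sum_le _ _).trans (Finset.sum_le_sum fun a ha => ?_)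
  -- Stability says nothing about the empty product; for `a = b` the factor `L` is allowed because
  -- `1 ≤ L`.
  rcases (Finset.mem_Iic.1 ha).eq_or_lt with rfl | hab
  · rw [transition_self]
    simp only [tsub_self, pow_zero, one_mul]
    rw [show Matrix.toEuclideanLin (1 : Matrix (Fin n) (Fin n) ℝ) (c a) = c a by simp]
    exact le_mul_of_one_le_left (norm_nonneg _) hL
  · rw [← mul_assoc]
    refine (norm_toEuclideanLin_le _ _).trans ?_
    exact mul_le_mul_of_nonneg_right (hΨ a b hab) (norm_nonneg _)

/-- This is Young's inequality for convolution with a geometric kernel, obtained by summing a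
one-step estimate. That step is convexity of the square, with `α y + c` read as the convex
combination of `y` and `c / (1 - α)`. -/
theorem sum_sq_convolution_le {α : ℝ} (hα : α ∈ Set.Ioo (0 : ℝ) 1) {y c : Fin (T + 1) → ℝ}
    (h0 : y 0 = c 0) (hy : ∀ t : Fin T, y t.succ = α * y t.castSucc + c t.succ) :
    ∑ t, y t ^ 2 ≤ (1 / (1 - α)) ^ 2 * ∑ t, c t ^ 2 := by
  obtain ⟨hα0, hα1⟩ := hα
  have h1α : 0 < 1 - α := by linarith
  have hstep : ∀ t : Fin T, y t.succ ^ 2 ≤ α * y t.castSucc ^ 2 + 1 / (1 - α) * c t.succ ^ 2 := by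
    intro t
    rw [hy, div_mul_eq_mul_div, one_mul]
    have : α * y t.castSucc ^ 2 + c t.succ ^ 2 / (1 - α) - (α * y t.castSucc + c t.succ) ^ 2
        = α / (1 - α) * ((1 - α) * y t.castSucc - c t.succ) ^ 2 := by
      field_simp; ring
    have h2 : 0 ≤ α / (1 - α) * ((1 - α) * y t.castSucc - c t.succ) ^ 2 := by positivity
    linarith
  have hsum : ∑ t, y t ^ 2 ≤ α * ∑ t, y t ^ 2 + 1 / (1 - α) * ∑ t, c t ^ 2 := by
    have hc : c 0 ^ 2 ≤ 1 / (1 - α) * c 0 ^ 2 := by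
      refine le_mul_of_one_le_left (sq_nonneg _) ?_
      rw [le_div_iff₀ h1α]; linarith
    calc ∑ t, y t ^ 2 = c 0 ^ 2 + ∑ t : Fin T, y t.succ ^ 2 := by rw [Fin.sum_univ_succ, h0]
      _ ≤ 1 / (1 - α) * c 0 ^ 2
          + ∑ t : Fin T, (α * y t.castSucc ^ 2 + 1 / (1 - α) * c t.succ ^ 2) :=
        add_le_add hc (Finset.sum_le_sum fun t _ => hstep t)
      _ = α * ∑ t : Fin T, y t.castSucc ^ 2 + 1 / (1 - α) * ∑ t, c t ^ 2 := by
        rw [Finset.sum_add_distrib, ← Finset.mul_sum, ← Finset.mul_sum,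
          Fin.sum_univ_succ (fun t => c t ^ 2)]
        ring
      _ ≤ _ := by
        rw [Fin.sum_univ_castSucc (fun t => y t ^ 2)]
        nlinarith [sq_nonneg (y (Fin.last T))]
  have : (1 - α) * ∑ t, y t ^ 2 ≤ 1 / (1 - α) * ∑ t, c t ^ 2 := by linarith
  rw [← le_div_iff₀' h1α] at this
  refine this.trans (le_of_eq ?_)
  field_simp

/-- The geometric majorant of `‖x‖` satisfies a scalar recursion with rate `α`, so the factor `L /
(1 - α)` does not depend on the horizon. -/
theorem sum_norm_sq_le_of_stable {L α : ℝ} (hL : 1 ≤ L) (hα : α ∈ Set.Ioo (0 : ℝ) 1)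
    (Ψ : Fin T → Matrix (Fin n) (Fin n) ℝ)
    (hΨ : ∀ a b : Fin (T + 1), a < b → ‖transition Ψ a b‖ ≤ L * α ^ ((b : ℕ) - (a : ℕ)))
    {x c : Fin (T + 1) → Vec n} (h0 : x 0 = c 0)
    (hx : ∀ t : Fin T, x t.succ = Matrix.toEuclideanLin (Ψ t) (x t.castSucc) + c t.succ) :
    ∑ t, ‖x t‖ ^ 2 ≤ (L / (1 - α)) ^ 2 * ∑ t, ‖c t‖ ^ 2 := by
  set y : Fin (T + 1) → ℝ := fun b => ∑ a ∈ Finset.Iic b, α ^ ((b : ℕ) - (a : ℕ)) * ‖c a‖ with hy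
  have hy0 : y 0 = ‖c 0‖ := by
    have : Finset.Iic (0 : Fin (T + 1)) = {0} := by
      ext a; simp
    simp [hy, this]
  have hys : ∀ t : Fin T, y t.succ = α * y t.castSucc + ‖c t.succ‖ := by
    intro t
    have : Finset.Iic t.succ = insert t.succ (Finset.Iic t.castSucc) := by
      ext a
      simp only [Finset.mem_Iic, Finset.mem_insert, Fin.le_def, Fin.ext_iff, Fin.val_succ,
        Fin.val_castSucc]
      omega
    simp only [hy]
    rw [this, Finset.sum_insert (by simp), Finset.mul_sum, add_comm]
    congr 1
    · refine Finset.sum_congr rfl fun a ha => ?_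
      have : (a : ℕ) ≤ t := by simpa [Fin.le_def] using ha
      rw [← mul_assoc, ← pow_succ']
      congr 2
      simp only [Fin.val_succ, Fin.val_castSucc]
      omega
    · simp
  calc ∑ t, ‖x t‖ ^ 2 ≤ ∑ t, (L * y t) ^ 2 := by
        refine Finset.sum_le_sum fun t _ => ?_
        exact pow_le_pow_left₀ (norm_nonneg _) (norm_le_sum_pow hL Ψ hΨ h0 hx t) 2
    _ = L ^ 2 * ∑ t, y t ^ 2 := by rw [Finset.mul_sum]; simp only [mul_pow]
    _ ≤ L ^ 2 * ((1 / (1 - α)) ^ 2 * ∑ t, ‖c t‖ ^ 2) :=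
        mul_le_mul_of_nonneg_left (sum_sq_convolution_le hα hy0 hys) (sq_nonneg _)
    _ = _ := by rw [div_eq_mul_one_div, mul_pow]; ring

end Recursion

/-! ### Inequalities between the constants -/

section Constants

variable {L α γ : ℝ}

/-- The bound `(1 + L) L / (1 - α)` of the right inverse of the constraint operator. -/
noncomputable def constσ (L α : ℝ) : ℝ := (1 + L) * L / (1 - α)

theorem one_le_constσ (hL : 1 ≤ L) (hα : α ∈ Set.Ioo (0 : ℝ) 1) : 1 ≤ constσ L α := by
  rw [constσ, le_div_iff₀ (by linarith [hα.2])]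
  nlinarith [hα.1]

theorem constγF_eq (hα : α ∈ Set.Ioo (0 : ℝ) 1) (hL : 1 ≤ L) :
    constγF L α = (constσ L α ^ 2)⁻¹ := by
  have : 1 - α ≠ 0 := by linarith [hα.2]
  rw [constγF, constσ]
  field_simp

theorem constγG_pos (hL : 1 ≤ L) (hα : α ∈ Set.Ioo (0 : ℝ) 1) (hγ : γ ∈ Set.Ioc (0 : ℝ) 1) :
    0 < constγG L α γ := by
  have h1 : 0 < 1 - α := by linarith [hα.2]
  have h2 := hγ.1
  rw [constγG]; positivity

theorem constγG_le (hL : 1 ≤ L) (hα : α ∈ Set.Ioo (0 : ℝ) 1) (hγ : γ ∈ Set.Ioc (0 : ℝ) 1) :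
    constγG L α γ ≤ 1 := by
  have h1 : 0 < 1 - α := by linarith [hα.2]
  rw [constγG, div_le_one (by positivity)]
  have h2 : (1 - α) ^ 2 ≤ 1 := by nlinarith [hα.1]
  have h3 : 1 ≤ (1 + L) ^ 2 := by nlinarith
  have h4 : 1 ≤ L ^ 4 := one_le_pow₀ hL
  have h5 : 1 ≤ (1 + L) ^ 2 * L ^ 4 := one_le_mul_of_one_le_of_one_le h3 h4
  have h6 : γ * (1 - α) ^ 2 ≤ 1 := mul_le_one₀ hγ.2 (sq_nonneg _) h2
  linarith

/-- Here `γ_F = σ⁻²`, and `γ_H` is far smaller than needed. The left side is at most `5 L² σ² /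
γ_G`, while the middle term of `γ_H⁻¹` alone is at least `12 L² σ² / γ_G`. -/
theorem saddle_const_le (hL : 1 ≤ L) (hα : α ∈ Set.Ioo (0 : ℝ) 1) (hγ : γ ∈ Set.Ioc (0 : ℝ) 1) :
    (1 + L * constσ L α) * (L * constσ L α / constγG L α γ + constσ L α) + constσ L α
      ≤ (constγH L α γ)⁻¹ := by
  have hσ := one_le_constσ hL hα
  have hg := constγG_pos hL hα hγ
  have hg1 := constγG_le hL hα hγ
  rw [constγH, inv_inv, constμ, constγF_eq hα hL, constLH]
  set σ := constσ L α
  set g := constγG L α γ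
  have hσ2 : σ ≤ σ ^ 2 := by nlinarith
  have hinv : 1 ≤ 1 / g := by rw [le_div_iff₀ hg]; linarith
  have hupper : (1 + L * σ) * (L * σ / g + σ) + σ ≤ 5 * L ^ 2 * σ ^ 2 * (1 / g) := by
    have hLσ : 1 ≤ L * σ := one_le_mul_of_one_le_of_one_le hL hσ
    have h1 : L * σ / g + σ ≤ 2 * (L * σ) * (1 / g) := by
      have : σ ≤ L * σ * (1 / g) := by nlinarith
      rw [div_eq_mul_one_div]; linarith
    have h2 : (1 + L * σ) * (L * σ / g + σ) ≤ (2 * (L * σ)) * (2 * (L * σ) * (1 / g)) :=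
      mul_le_mul (by linarith) h1 (by positivity) (by positivity)
    have h3 : σ ≤ (L * σ) * (L * σ) * (1 / g) := by
      have : L * σ ≤ (L * σ) * (L * σ) := by nlinarith
      nlinarith
    nlinarith
  have hμ : 0 ≤ (2 * (2 * L + 1) ^ 2 / g + g + (2 * L + 1)) / (σ ^ 2)⁻¹ := by positivity
  set μ := (2 * (2 * L + 1) ^ 2 / g + g + (2 * L + 1)) / (σ ^ 2)⁻¹
  have hfac : 4 * L ^ 2 * (1 / g) * 3 ≤
      (1 + 4 * (2 * L + 1) / g + 4 * (2 * L + 1) ^ 2 / g ^ 2) * (2 * L + 1) := by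
    have h1 : 4 * L ^ 2 * (1 / g) ≤ 4 * (2 * L + 1) ^ 2 / g ^ 2 := by
      have : 4 * (2 * L + 1) ^ 2 / g ^ 2 = 4 * (2 * L + 1) ^ 2 * (1 / g) * (1 / g) := by
        field_simp
      rw [this]
      have h2 : 4 * L ^ 2 * (1 / g) ≤ 4 * (2 * L + 1) ^ 2 * (1 / g) := by
        gcongr; linarith
      refine h2.trans (le_mul_of_one_le_right (by positivity) hinv)
    refine mul_le_mul (h1.trans ?_) (by linarith) (by norm_num) (by positivity)
    have : 0 ≤ 4 * (2 * L + 1) / g := by positivity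
    linarith
  have hlower : 4 * L ^ 2 * (1 / g) * 3 * σ ^ 2 ≤
      (1 + 4 * (2 * L + 1) / g + 4 * (2 * L + 1) ^ 2 / g ^ 2)
        * ((2 * L + 1) * (1 + μ * (2 * L + 1)) / (σ ^ 2)⁻¹) := by
    rw [div_inv_eq_mul, ← mul_assoc, ← mul_assoc]
    refine mul_le_mul_of_nonneg_right (hfac.trans ?_) (sq_nonneg _)
    refine le_mul_of_one_le_right (by positivity) ?_
    have : 0 ≤ μ * (2 * L + 1) := by positivity
    linarith
  have h2g : 0 ≤ 2 / g := by positivity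
  have : 0 ≤ L ^ 2 * σ ^ 2 * (1 / g) := by positivity
  nlinarith

theorem constγH_pos (hL : 1 ≤ L) (hα : α ∈ Set.Ioo (0 : ℝ) 1) (hγ : γ ∈ Set.Ioc (0 : ℝ) 1) :
    0 < constγH L α γ := by
  have hσ := one_le_constσ hL hα
  have hg := constγG_pos hL hα hγ
  rw [← inv_pos]
  refine lt_of_lt_of_le ?_ (saddle_const_le hL hα hγ)
  positivity

theorem two_le_inv_constγH (hL : 1 ≤ L) (hα : α ∈ Set.Ioo (0 : ℝ) 1)
    (hγ : γ ∈ Set.Ioc (0 : ℝ) 1) : 2 ≤ (constγH L α γ)⁻¹ := by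
  have hσ := one_le_constσ hL hα
  have hg := constγG_pos hL hα hγ
  refine le_trans ?_ (saddle_const_le hL hα hγ)
  have h1 : 1 ≤ 1 + L * constσ L α := by nlinarith
  have h2 : 1 ≤ L * constσ L α / constγG L α γ + constσ L α := by
    have : 0 ≤ L * constσ L α / constγG L α γ := by positivity
    linarith
  nlinarith [one_le_mul_of_one_le_of_one_le h1 h2]

theorem constγH_le (hL : 1 ≤ L) (hα : α ∈ Set.Ioo (0 : ℝ) 1) (hγ : γ ∈ Set.Ioc (0 : ℝ) 1) :
    constγH L α γ ≤ 1 / 2 := by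
  have := two_le_inv_constγH hL hα hγ
  rw [le_inv_comm₀ (by norm_num) (constγH_pos hL hα hγ)] at this
  linarith

theorem rate_sq (hL : 1 ≤ L) (hα : α ∈ Set.Ioo (0 : ℝ) 1) (hγ : γ ∈ Set.Ioc (0 : ℝ) 1) :
    rate L α γ ^ 2 =
      (constLH L ^ 2 - constγH L α γ ^ 2) / (constLH L ^ 2 + constγH L α γ ^ 2) := by
  have h1 := constγH_pos hL hα hγ
  have h2 := constγH_le hL hα hγ
  rw [rate, Real.sq_sqrt]
  refine div_nonneg ?_ (by positivity)
  rw [constLH]; nlinarith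

theorem rate_mem (hL : 1 ≤ L) (hα : α ∈ Set.Ioo (0 : ℝ) 1) (hγ : γ ∈ Set.Ioc (0 : ℝ) 1) :
    rate L α γ ∈ Set.Ioo (0 : ℝ) 1 := by
  have h1 := constγH_pos hL hα hγ
  have h2 := constγH_le hL hα hγ
  have h3 : 0 < constLH L ^ 2 - constγH L α γ ^ 2 := by rw [constLH]; nlinarith
  refine ⟨Real.sqrt_pos.2 (div_pos h3 (by positivity)), ?_⟩
  rw [rate, Real.sqrt_lt' one_pos, div_lt_iff₀ (by positivity)]
  nlinarith [sq_pos_of_pos h1]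

/-- This is the absorption condition `K * ε ≤ 1 / 2` for the weights `ρ ^ |t - t'|`. -/
theorem weight_defect_le (hL : 1 ≤ L) (hα : α ∈ Set.Ioo (0 : ℝ) 1) (hγ : γ ∈ Set.Ioc (0 : ℝ) 1) :
    (constγH L α γ)⁻¹ * (((rate L α γ)⁻¹ - 1) * (2 * L)) ≤ 1 / 2 := by
  have h1 := constγH_pos hL hα hγ
  have h2 := constγH_le hL hα hγ
  obtain ⟨hρ0, hρ1⟩ := rate_mem hL hα hγ
  have hsq := rate_sq hL hα hγ
  rw [constLH] at hsq
  set ρ := rate L α γ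
  set c := constγH L α γ
  have h3 : 0 < (2 * L + 1) ^ 2 - c ^ 2 := by nlinarith
  -- From `ρ⁻² = 1 + 2δ` and `ρ⁻² - 1 ≥ 2 (ρ⁻¹ - 1)`.
  have h4 : ρ⁻¹ - 1 ≤ c ^ 2 / ((2 * L + 1) ^ 2 - c ^ 2) := by
    have h5 : (ρ⁻¹) ^ 2 = 1 + 2 * (c ^ 2 / ((2 * L + 1) ^ 2 - c ^ 2)) := by
      rw [inv_pow, hsq]; field_simp; ring
    nlinarith [sq_nonneg (ρ⁻¹ - 1)]
  have h5 : c ^ 2 / ((2 * L + 1) ^ 2 - c ^ 2) * (2 * L) ≤ c * (1 / 2) := by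
    rw [div_mul_eq_mul_div, div_le_iff₀ h3]
    have : c * (2 * L) ≤ 1 / 2 * ((2 * L + 1) ^ 2 - c ^ 2) := by nlinarith
    nlinarith
  rw [inv_mul_le_iff₀ h1]
  refine le_trans (mul_le_mul_of_nonneg_right h4 (by linarith)) h5

theorem four_mul_inv_le_constC (hL : 1 ≤ L) (hα : α ∈ Set.Ioo (0 : ℝ) 1)
    (hγ : γ ∈ Set.Ioc (0 : ℝ) 1) : 4 * (constγH L α γ)⁻¹ ≤ constC L α γ := by
  have h1 := constγH_pos hL hα hγ
  have h2 := two_le_inv_constγH hL hα hγ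
  obtain ⟨hρ0, hρ1⟩ := rate_mem hL hα hγ
  have h3 : constC L α γ = constLH L * ((constγH L α γ)⁻¹ ^ 2) * (rate L α γ)⁻¹ := by
    rw [constC]; field_simp
  have h4 : 1 ≤ (rate L α γ)⁻¹ := (one_le_inv₀ hρ0).2 hρ1.le
  have h5 : 2 ≤ constLH L := by rw [constLH]; linarith
  rw [h3]
  refine le_trans ?_ (le_mul_of_one_le_right (by positivity) h4)
  nlinarith [mul_le_mul_of_nonneg_right h5 (sq_nonneg (constγH L α γ)⁻¹)]

end Constants

/-! ### Geometric weights centred at a stage -/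

section Geometric

theorem sum_pow_natAbs_le {ρ : ℝ} (hρ : ρ ∈ Set.Ioo (0 : ℝ) 1) (T : ℕ) (t : Fin (T + 1)) :
    ∑ t' : Fin (T + 1), ρ ^ ((t : ℤ) - (t' : ℤ)).natAbs ≤ 2 / (1 - ρ) := by
  obtain ⟨h0, h1⟩ := hρ
  have hgeom : ∀ n : ℕ, ∑ i ∈ Finset.range n, ρ ^ i ≤ 1 / (1 - ρ) := by
    intro n
    rw [geom_sum_eq h1.ne, ← neg_div_neg_eq, neg_sub, neg_sub]
    have : 0 < 1 - ρ := by linarith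
    gcongr
    linarith [pow_pos h0 n]
  -- On each side of `t` the distance to `t` is injective, so each half of the sum is dominated by a
  -- geometric series.
  have hinj : ∀ s : Finset (Fin (T + 1)),
      Set.InjOn (fun t' : Fin (T + 1) => ((t : ℤ) - (t' : ℤ)).natAbs) s →
      ∑ t' ∈ s, ρ ^ ((t : ℤ) - (t' : ℤ)).natAbs ≤ 1 / (1 - ρ) := by
    intro s hs
    rw [← Finset.sum_image (f := fun i : ℕ => ρ ^ i) hs]
    refine le_trans (Finset.sum_le_sum_of_subset_of_nonneg (t := Finset.range (T + 1)) ?_ ?_)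
      (hgeom _)
    · intro i hi
      simp only [Finset.mem_image] at hi
      obtain ⟨t', -, rfl⟩ := hi
      have := t.2; have := t'.2
      simp only [Finset.mem_range]; omega
    · intro i _ _; positivity
  rw [← Finset.sum_filter_add_sum_filter_not Finset.univ (fun t' => t' ≤ t)]
  have h2 : 2 / (1 - ρ) = 1 / (1 - ρ) + 1 / (1 - ρ) := by ring
  rw [h2]
  refine add_le_add (hinj _ ?_) (hinj _ ?_)
  · intro a ha b hb hab
    simp only [Finset.coe_filter, Finset.mem_univ, true_and, Set.mem_ofPred_eq, Fin.le_def] at ha hb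
    simp only at hab
    exact Fin.ext (by omega)
  · intro a ha b hb hab
    simp only [Finset.coe_filter, Finset.mem_univ, true_and, Set.mem_ofPred_eq, Fin.le_def] at ha hb
    simp only at hab
    exact Fin.ext (by omega)

/-- Neighbouring weights differ by one factor `ρ`. Both comparisons are needed: with the earlier
weight for the constraint equation, with the later one for the multiplier equation. -/
theorem abs_sub_pow_natAbs_le {ρ : ℝ} (hρ : ρ ∈ Set.Ioo (0 : ℝ) 1) {T : ℕ} (t : Fin (T + 1))
    (s : Fin T) :
    |ρ ^ ((t : ℤ) - (s.castSucc : ℤ)).natAbs - ρ ^ ((t : ℤ) - (s.succ : ℤ)).natAbs|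
        ≤ (ρ⁻¹ - 1) * ρ ^ ((t : ℤ) - (s.castSucc : ℤ)).natAbs ∧
    |ρ ^ ((t : ℤ) - (s.castSucc : ℤ)).natAbs - ρ ^ ((t : ℤ) - (s.succ : ℤ)).natAbs|
        ≤ (ρ⁻¹ - 1) * ρ ^ ((t : ℤ) - (s.succ : ℤ)).natAbs := by
  obtain ⟨h0, h1⟩ := hρ
  have key : ∀ n : ℕ, |ρ ^ n - ρ ^ (n + 1)| ≤ (ρ⁻¹ - 1) * ρ ^ n ∧
      |ρ ^ n - ρ ^ (n + 1)| ≤ (ρ⁻¹ - 1) * ρ ^ (n + 1) := by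
    intro n
    have hp : 0 < ρ ^ n := pow_pos h0 n
    have h2 : ρ ^ n - ρ ^ (n + 1) = (1 - ρ) * ρ ^ n := by rw [pow_succ]; ring
    have h3 : (ρ⁻¹ - 1) * ρ ^ (n + 1) = (1 - ρ) * ρ ^ n := by
      rw [pow_succ]; field_simp
    have h4 : 1 - ρ ≤ ρ⁻¹ - 1 := by
      have : ρ⁻¹ * ρ = 1 := inv_mul_cancel₀ h0.ne'
      have : 1 ≤ ρ⁻¹ := (one_le_inv₀ h0).2 h1.le
      nlinarith
    rw [h3, h2, abs_of_nonneg (by nlinarith)]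
    exact ⟨mul_le_mul_of_nonneg_right h4 hp.le, le_rfl⟩
  simp only [Fin.val_castSucc, Fin.val_succ, Nat.cast_add, Nat.cast_one]
  rcases le_or_gt (t : ℕ) s with h | h
  · rw [show ((t : ℤ) - ((s : ℤ) + 1)).natAbs = ((t : ℤ) - (s : ℤ)).natAbs + 1 by omega]
    exact key _
  · rw [show ((t : ℤ) - (s : ℤ)).natAbs = ((t : ℤ) - ((s : ℤ) + 1)).natAbs + 1 by omega, abs_sub_comm]
    exact (key _).symm

end Geometric

end StochLQ

/-! ### Scenario trees and the Hilbert space of processes on them -/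

namespace StochLQ

set_option linter.unusedSectionVars false

/-- A finite set `ι` of scenarios with positive weights, and for every stage `t` a set `N t` of
nodes, such that the scenario `i` passes through the node `node t i` at stage `t`. -/
structure ScenarioTree (T : ℕ) (ι : Type*) [Fintype ι] (N : Fin (T + 1) → Type*) where
  weight : ι → ℝ
  weight_pos : ∀ i, 0 < weight i
  node : ∀ t, ι → N t
  node_surjective : ∀ t, Function.Surjective (node t)
  parent : ∀ t : Fin T, N t.succ → N t.castSucc
  parent_node : ∀ t i, parent t (node t.succ i) = node t.castSucc i

namespace ScenarioTree

open scoped InnerProductSpace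

variable {T : ℕ} {ι : Type*} [Fintype ι] {N : Fin (T + 1) → Type*}

/-- Processes on a scenario tree, with the inner product `E[∑ₜ ⟪v_t, w_t⟫]`. -/
@[ext]
structure NodeFamily (S : ScenarioTree T ι N) (V : Type*) where
  toFun : ∀ t, N t → V

instance (S : ScenarioTree T ι N) (V : Type*) : CoeFun (S.NodeFamily V) fun _ => ∀ t, N t → V :=
  ⟨NodeFamily.toFun⟩

/-- A process as a family of functions. -/
@[reducible] def NodeFamily.equiv (S : ScenarioTree T ι N) (V : Type*) :
    S.NodeFamily V ≃ (∀ t, N t → V) :=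
  ⟨NodeFamily.toFun, NodeFamily.mk, fun _ => rfl, fun _ => rfl⟩

variable {S : ScenarioTree T ι N} {V : Type*} [NormedAddCommGroup V] [InnerProductSpace ℝ V]

instance : AddCommGroup (S.NodeFamily V) := (NodeFamily.equiv S V).addCommGroup

noncomputable instance : Module ℝ (S.NodeFamily V) := (NodeFamily.equiv S V).module ℝ

@[simp] theorem NodeFamily.add_apply (v w : S.NodeFamily V) (t : Fin (T + 1)) (h : N t) :
    (v + w) t h = v t h + w t h := rfl

@[simp] theorem NodeFamily.sub_apply (v w : S.NodeFamily V) (t : Fin (T + 1)) (h : N t) :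
    (v - w) t h = v t h - w t h := rfl

@[simp] theorem NodeFamily.smul_apply (r : ℝ) (v : S.NodeFamily V) (t : Fin (T + 1)) (h : N t) :
    (r • v) t h = r • v t h := rfl

theorem NodeFamily.ext_node {v w : S.NodeFamily V} (H : ∀ t h, v t h = w t h) : v = w :=
  NodeFamily.ext (funext fun t => funext fun h => H t h)

/-- The inner product of processes. -/
@[reducible] noncomputable def NodeFamily.core (S : ScenarioTree T ι N) (V : Type*)
    [NormedAddCommGroup V] [InnerProductSpace ℝ V] : InnerProductSpace.Core ℝ (S.NodeFamily V) where
  inner v w := ∑ i, S.weight i * ∑ t, ⟪v t (S.node t i), w t (S.node t i)⟫_ℝ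
  conj_inner_symm v w := by
    simp only [conj_trivial]
    exact Finset.sum_congr rfl fun i _ => by
      congr 1; exact Finset.sum_congr rfl fun t _ => real_inner_comm _ _
  re_inner_nonneg v := by
    simp only [RCLike.re_to_real]
    exact Finset.sum_nonneg fun i _ => mul_nonneg (S.weight_pos i).le
      (Finset.sum_nonneg fun t _ => real_inner_self_nonneg)
  add_left u v w := by
    simp only [NodeFamily.add_apply, inner_add_left, Finset.sum_add_distrib, mul_add]
  smul_left v w r := by
    simp only [NodeFamily.smul_apply, real_inner_smul_left, conj_trivial, Finset.mul_sum]
    exact Finset.sum_congr rfl fun i _ => Finset.sum_congr rfl fun t _ => by ring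
  definite v hv := by
    have h1 := (Finset.sum_eq_zero_iff_of_nonneg fun i _ => mul_nonneg (S.weight_pos i).le
      (Finset.sum_nonneg fun t _ => real_inner_self_nonneg)).1 hv
    refine NodeFamily.ext_node fun t h => ?_
    -- Definiteness holds because every node lies on a scenario, and every scenario has positive
    -- weight.
    obtain ⟨i, rfl⟩ := S.node_surjective t h
    have h2 := (mul_eq_zero.1 (h1 i (Finset.mem_univ i))).resolve_left (S.weight_pos i).ne'
    have h3 := (Finset.sum_eq_zero_iff_of_nonneg fun t _ => real_inner_self_nonneg).1 h2 t
      (Finset.mem_univ t)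
    exact inner_self_eq_zero.1 h3

noncomputable instance : NormedAddCommGroup (S.NodeFamily V) :=
  (NodeFamily.core S V).toNormedAddCommGroup

noncomputable instance : InnerProductSpace ℝ (S.NodeFamily V) :=
  InnerProductSpace.ofCore (NodeFamily.core S V).toCore

theorem NodeFamily.inner_def (v w : S.NodeFamily V) :
    ⟪v, w⟫_ℝ = ∑ i, S.weight i * ∑ t, ⟪v t (S.node t i), w t (S.node t i)⟫_ℝ := rfl

theorem NodeFamily.norm_sq (v : S.NodeFamily V) :
    ‖v‖ ^ 2 = ∑ i, S.weight i * ∑ t, ‖v t (S.node t i)‖ ^ 2 := by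
  rw [← real_inner_self_eq_norm_sq, NodeFamily.inner_def]
  simp only [real_inner_self_eq_norm_sq]

instance [FiniteDimensional ℝ V] : FiniteDimensional ℝ (S.NodeFamily V) := by
  have : ∀ t, Finite (N t) := fun t => Finite.of_surjective _ (S.node_surjective t)
  exact Module.Finite.equiv ((NodeFamily.equiv S V).linearEquiv ℝ).symm

variable {V' : Type*} [NormedAddCommGroup V'] [InnerProductSpace ℝ V']

/-- Since the weights are positive, pathwise estimates integrate. Thus the stochastic operator
bounds reduce to deterministic ones along each scenario. -/
theorem NodeFamily.norm_le_of_scenario {v : S.NodeFamily V} {w : S.NodeFamily V'} {c : ℝ} (hc : 0 ≤ c)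
    (H : ∀ i, ∑ t, ‖v t (S.node t i)‖ ^ 2 ≤ c ^ 2 * ∑ t, ‖w t (S.node t i)‖ ^ 2) :
    ‖v‖ ≤ c * ‖w‖ := by
  refine le_of_sq_le_sq ?_ (by positivity)
  rw [mul_pow, NodeFamily.norm_sq, NodeFamily.norm_sq, Finset.mul_sum]
  refine Finset.sum_le_sum fun i _ => ?_
  have := mul_le_mul_of_nonneg_left (H i) (S.weight_pos i).le
  linarith

theorem NodeFamily.norm_le_of_node {v : S.NodeFamily V} {w : S.NodeFamily V'} {c : ℝ} (hc : 0 ≤ c)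
    (H : ∀ t h, ‖v t h‖ ≤ c * ‖w t h‖) : ‖v‖ ≤ c * ‖w‖ := by
  refine NodeFamily.norm_le_of_scenario hc fun i => ?_
  rw [Finset.mul_sum]
  refine Finset.sum_le_sum fun t _ => ?_
  rw [← mul_pow]
  exact pow_le_pow_left₀ (norm_nonneg _) (H _ _) 2

/-- The root mean square of a process at stage `t`. -/
noncomputable def NodeFamily.rms (v : S.NodeFamily V) (t : Fin (T + 1)) : ℝ :=
  √(∑ i, S.weight i * ‖v t (S.node t i)‖ ^ 2)

theorem NodeFamily.norm_sq_eq_sum_rms (v : S.NodeFamily V) : ‖v‖ ^ 2 = ∑ t, v.rms t ^ 2 := by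
  have h : ∀ t, v.rms t ^ 2 = ∑ i, S.weight i * ‖v t (S.node t i)‖ ^ 2 := fun t =>
    Real.sq_sqrt (Finset.sum_nonneg fun i _ => mul_nonneg (S.weight_pos i).le (sq_nonneg _))
  simp only [h]
  rw [Finset.sum_comm, NodeFamily.norm_sq]
  simp only [Finset.mul_sum]

theorem NodeFamily.rms_nonneg (v : S.NodeFamily V) (t : Fin (T + 1)) : 0 ≤ v.rms t := Real.sqrt_nonneg _

theorem NodeFamily.rms_le_norm (v : S.NodeFamily V) (t : Fin (T + 1)) : v.rms t ≤ ‖v‖ := by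
  refine le_of_sq_le_sq ?_ (norm_nonneg _)
  rw [NodeFamily.norm_sq_eq_sum_rms]
  exact Finset.single_le_sum (f := fun t => v.rms t ^ 2) (fun t _ => sq_nonneg _)
    (Finset.mem_univ t)

theorem NodeFamily.norm_le_sum_rms (v : S.NodeFamily V) : ‖v‖ ≤ ∑ t, v.rms t := by
  refine le_of_sq_le_sq ?_ (Finset.sum_nonneg fun t _ => v.rms_nonneg t)
  rw [NodeFamily.norm_sq_eq_sum_rms]
  exact Finset.sum_sq_le_sq_sum_of_nonneg fun t _ => v.rms_nonneg t

theorem NodeFamily.rms_le_rms {v : S.NodeFamily V} {w : S.NodeFamily V'} {t : Fin (T + 1)}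
    (H : ∀ h, ‖v t h‖ ≤ ‖w t h‖) : v.rms t ≤ w.rms t := by
  refine Real.sqrt_le_sqrt (Finset.sum_le_sum fun i _ => ?_)
  exact mul_le_mul_of_nonneg_left (pow_le_pow_left₀ (norm_nonneg _) (H _) 2) (S.weight_pos i).le

/-- Multiplication of a process by a deterministic sequence. -/
noncomputable def scale (S : ScenarioTree T ι N) (V : Type*) [NormedAddCommGroup V] [InnerProductSpace ℝ V]
    (r : Fin (T + 1) → ℝ) : S.NodeFamily V →ₗ[ℝ] S.NodeFamily V where
  toFun v := ⟨fun t h => r t • v t h⟩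
  map_add' _ _ := NodeFamily.ext_node fun _ _ => smul_add _ _ _
  map_smul' _ _ := NodeFamily.ext_node fun _ _ => smul_comm _ _ _

theorem scale_apply (r : Fin (T + 1) → ℝ) (v : S.NodeFamily V) (t : Fin (T + 1)) (h : N t) :
    S.scale V r v t h = r t • v t h := rfl

theorem scale_isSymmetric (r : Fin (T + 1) → ℝ) : (S.scale V r).IsSymmetric := by
  intro v w
  simp only [NodeFamily.inner_def, scale_apply, real_inner_smul_left, real_inner_smul_right]

theorem rms_scale {r : Fin (T + 1) → ℝ} {t : Fin (T + 1)} (hr : 0 ≤ r t) (v : S.NodeFamily V) :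
    (S.scale V r v).rms t = r t * v.rms t := by
  have : ∑ i, S.weight i * ‖S.scale V r v t (S.node t i)‖ ^ 2
      = r t ^ 2 * ∑ i, S.weight i * ‖v t (S.node t i)‖ ^ 2 := by
    rw [Finset.mul_sum]
    refine Finset.sum_congr rfl fun i _ => ?_
    rw [scale_apply, norm_smul, mul_pow, Real.norm_eq_abs, sq_abs]
    ring
  rw [NodeFamily.rms, this, Real.sqrt_mul (sq_nonneg _), Real.sqrt_sq hr, NodeFamily.rms]

/-! ### The linear-quadratic operators on a scenario tree -/

section LQ

variable {Ξ : Type*} {nx nu : ℕ} (S : ScenarioTree T ι N) (D : LQData Ξ nx nu)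
  (val : ∀ t, N t → Ξ)

/-- The homogeneous part of the dynamics, as an operator on processes. -/
noncomputable def shift : S.NodeFamily (StateControl nx nu) →ₗ[ℝ] S.NodeFamily (Vec nx) where
  toFun w := ⟨fun t => Fin.cases (motive := fun t => N t → Vec nx) (fun _ => 0)
    (fun s h => Matrix.toEuclideanLin (D.A (val s.succ h)) (w s.castSucc (S.parent s h)).fst
      + Matrix.toEuclideanLin (D.B (val s.succ h)) (w s.castSucc (S.parent s h)).snd) t⟩
  map_add' v w := by
    refine NodeFamily.ext_node fun t h => ?_
    cases t using Fin.cases with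
    | zero => simp
    | succ s => simp only [NodeFamily.add_apply, Fin.cases_succ, WithLp.add_fst, WithLp.add_snd,
        map_add]; abel
  map_smul' c v := by
    refine NodeFamily.ext_node fun t h => ?_
    cases t using Fin.cases with
    | zero => simp
    | succ s => simp only [NodeFamily.smul_apply, Fin.cases_succ, WithLp.smul_fst, WithLp.smul_snd,
        map_smul, smul_add, RingHom.id_apply]

/-- The state component of a process. -/
noncomputable def state : S.NodeFamily (StateControl nx nu) →ₗ[ℝ] S.NodeFamily (Vec nx) where
  toFun w := ⟨fun t h => (w t h).fst⟩
  map_add' _ _ := rfl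
  map_smul' _ _ := rfl

/-- The linear part of the dynamic constraints, as an operator on processes. -/
noncomputable def constraint : S.NodeFamily (StateControl nx nu) →ₗ[ℝ] S.NodeFamily (Vec nx) :=
  S.state - S.shift D val

/-- The Hessian of the cost, as an operator on processes. -/
noncomputable def hessian : S.NodeFamily (StateControl nx nu) →ₗ[ℝ] S.NodeFamily (StateControl nx nu) where
  toFun w := ⟨fun t h => WithLp.toLp 2 (Matrix.toEuclideanLin (D.Q (val t h)) (w t h).fst,
    Matrix.toEuclideanLin (D.R (val t h)) (w t h).snd)⟩
  map_add' v w := by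
    refine NodeFamily.ext_node fun t h => ?_
    simp only [NodeFamily.add_apply, WithLp.add_fst, WithLp.add_snd, map_add]; rfl
  map_smul' c v := by
    refine NodeFamily.ext_node fun t h => ?_
    simp only [NodeFamily.smul_apply, WithLp.smul_fst, WithLp.smul_snd, map_smul]; rfl

variable {S D val}

theorem shift_zero (w : S.NodeFamily (StateControl nx nu)) (h : N 0) :
    S.shift D val w 0 h = 0 := rfl

theorem shift_succ (w : S.NodeFamily (StateControl nx nu)) (s : Fin T) (h : N s.succ) :
    S.shift D val w s.succ h =
      Matrix.toEuclideanLin (D.A (val s.succ h)) (w s.castSucc (S.parent s h)).fst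
      + Matrix.toEuclideanLin (D.B (val s.succ h)) (w s.castSucc (S.parent s h)).snd := rfl

theorem constraint_apply (w : S.NodeFamily (StateControl nx nu)) (t : Fin (T + 1)) (h : N t) :
    S.constraint D val w t h = (w t h).fst - S.shift D val w t h := rfl

theorem hessian_apply (w : S.NodeFamily (StateControl nx nu)) (t : Fin (T + 1)) (h : N t) :
    S.hessian D val w t h = WithLp.toLp 2 (Matrix.toEuclideanLin (D.Q (val t h)) (w t h).fst,
      Matrix.toEuclideanLin (D.R (val t h)) (w t h).snd) := rfl

theorem inner_hessian_apply (v w : S.NodeFamily (StateControl nx nu)) (t : Fin (T + 1)) (h : N t) :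
    ⟪S.hessian D val v t h, w t h⟫_ℝ =
      ⟪Matrix.toEuclideanLin (D.Q (val t h)) (v t h).fst, (w t h).fst⟫_ℝ
        + ⟪Matrix.toEuclideanLin (D.R (val t h)) (v t h).snd, (w t h).snd⟫_ℝ :=
  WithLp.prod_inner_apply _ _

theorem isSymmetric_toEuclideanLin_of_isSymm {n : ℕ} {M : Matrix (Fin n) (Fin n) ℝ}
    (hM : M.IsSymm) : (Matrix.toEuclideanLin M).IsSymmetric :=
  Matrix.isSymmetric_toEuclideanLin_iff.2 (by
    rw [Matrix.IsHermitian, Matrix.conjTranspose_eq_transpose_of_trivial]; exact hM)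

theorem hessian_isSymmetric : (S.hessian D val).IsSymmetric := by
  intro v w
  rw [NodeFamily.inner_def, NodeFamily.inner_def]
  refine Finset.sum_congr rfl fun i _ => ?_
  congr 1
  refine Finset.sum_congr rfl fun t _ => ?_
  rw [inner_hessian_apply, real_inner_comm (S.hessian D val w _ _), inner_hessian_apply,
    isSymmetric_toEuclideanLin_of_isSymm (D.isSymm_Q _),
    isSymmetric_toEuclideanLin_of_isSymm (D.isSymm_R _), real_inner_comm,
    real_inner_comm (Matrix.toEuclideanLin (D.R _) _)]

theorem hessian_scale (r : Fin (T + 1) → ℝ) (v : S.NodeFamily (StateControl nx nu)) :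
    S.hessian D val (S.scale _ r v) = S.scale _ r (S.hessian D val v) := by
  refine NodeFamily.ext_node fun t h => ?_
  simp only [hessian_apply, scale_apply, WithLp.smul_fst, WithLp.smul_snd, map_smul]
  rfl

theorem state_scale (r : Fin (T + 1) → ℝ) (v : S.NodeFamily (StateControl nx nu)) :
    S.state (S.scale _ r v) = S.scale _ r (S.state v) := rfl

/-- The standing assumptions on the linear-quadratic problem, on a scenario tree. -/
structure Assumption (S : ScenarioTree T ι N) (D : LQData Ξ nx nu) (val : ∀ t, N t → Ξ)
    (L α γ : ℝ) : Prop where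
  norm_A : ∀ t h, ‖D.A (val t h)‖ ≤ L
  norm_B : ∀ t h, ‖D.B (val t h)‖ ≤ L
  norm_Q : ∀ t h, ‖D.Q (val t h)‖ ≤ L
  norm_R : ∀ t h, ‖D.R (val t h)‖ ≤ L
  posSemidef_Q : ∀ t h, (D.Q (val t h)).PosSemidef
  posDef_R : ∀ t h, (D.R (val t h) - γ • (1 : Matrix (Fin nu) (Fin nu) ℝ)).PosSemidef
  stabilizable : ∃ K : (t : Fin T) → N t.castSucc → Matrix (Fin nu) (Fin nx) ℝ,
    (∀ t h, ‖K t h‖ ≤ L) ∧ ∀ i, ∀ a b : Fin (T + 1), a < b →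
      ‖transition (fun t => D.A (val t.succ (S.node t.succ i))
        - D.B (val t.succ (S.node t.succ i)) * K t (S.node t.castSucc i)) a b‖
        ≤ L * α ^ ((b : ℕ) - (a : ℕ))
  detectable : ∃ K : (t : Fin T) → N t.succ → Matrix (Fin nx) (Fin nx) ℝ,
    (∀ t h, ‖K t h‖ ≤ L) ∧ ∀ i, ∀ a b : Fin (T + 1), a < b →
      ‖transition (fun t => D.A (val t.succ (S.node t.succ i))
        - K t (S.node t.succ i) * CFC.sqrt (D.Q (val t.castSucc (S.node t.castSucc i)))) a b‖
        ≤ L * α ^ ((b : ℕ) - (a : ℕ))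

theorem norm_sq_eq_fst_add_snd (w : StateControl nx nu) :
    ‖w‖ ^ 2 = ‖w.fst‖ ^ 2 + ‖w.snd‖ ^ 2 := WithLp.prod_norm_sq_eq_of_L2 w

variable {L α γ : ℝ}

theorem Assumption.norm_hessian_le (H : S.Assumption D val L α γ) (hL : 0 ≤ L)
    (v : S.NodeFamily (StateControl nx nu)) : ‖S.hessian D val v‖ ≤ L * ‖v‖ := by
  refine NodeFamily.norm_le_of_node hL fun t h => ?_
  refine le_of_sq_le_sq ?_ (by positivity)
  rw [mul_pow, norm_sq_eq_fst_add_snd, norm_sq_eq_fst_add_snd (v t h), hessian_apply, mul_add,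
    ← mul_pow, ← mul_pow]
  gcongr
  · exact (norm_toEuclideanLin_le _ _).trans
      (mul_le_mul_of_nonneg_right (H.norm_Q t h) (norm_nonneg _))
  · exact (norm_toEuclideanLin_le _ _).trans
      (mul_le_mul_of_nonneg_right (H.norm_R t h) (norm_nonneg _))

theorem norm_dynamics_le {A : Matrix (Fin nx) (Fin nx) ℝ} {B : Matrix (Fin nx) (Fin nu) ℝ}
    (hA : ‖A‖ ≤ L) (hB : ‖B‖ ≤ L) (w : StateControl nx nu) :
    ‖Matrix.toEuclideanLin A w.fst + Matrix.toEuclideanLin B w.snd‖ ≤ 2 * L * ‖w‖ := by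
  have hL : 0 ≤ L := (norm_nonneg A).trans hA
  have h1 : ‖w.fst‖ ≤ ‖w‖ := le_of_sq_le_sq (by
    rw [norm_sq_eq_fst_add_snd]; nlinarith [sq_nonneg ‖w.snd‖]) (norm_nonneg _)
  have h2 : ‖w.snd‖ ≤ ‖w‖ := le_of_sq_le_sq (by
    rw [norm_sq_eq_fst_add_snd w]; nlinarith [sq_nonneg ‖w.fst‖]) (norm_nonneg _)
  have h3 := (norm_toEuclideanLin_le A w.fst).trans (mul_le_mul hA h1 (norm_nonneg _) hL)
  have h4 := (norm_toEuclideanLin_le B w.snd).trans (mul_le_mul hB h2 (norm_nonneg _) hL)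
  have := norm_add_le (Matrix.toEuclideanLin A w.fst) (Matrix.toEuclideanLin B w.snd)
  linarith

/-- If `v` is a stagewise multiple of the shift of `w`, it is bounded by any process `w'` that
dominates the same multiple of `w` up to the factor `δ`. -/
theorem Assumption.norm_le_of_succ (H : S.Assumption D val L α γ) (hL : 0 ≤ L) {δ : ℝ}
    (hδ : 0 ≤ δ) {v : S.NodeFamily (Vec nx)} {w : S.NodeFamily (StateControl nx nu)}
    {w' : S.NodeFamily (StateControl nx nu)} (hv0 : ∀ h, v 0 h = 0) {r : Fin T → ℝ}
    (hv : ∀ s h, v s.succ h = r s • S.shift D val w s.succ h)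
    (hw : ∀ s h, |r s| * ‖w (Fin.castSucc s) h‖ ≤ δ * ‖w' s.castSucc h‖) :
    ‖v‖ ≤ δ * (2 * L) * ‖w'‖ := by
  refine NodeFamily.norm_le_of_scenario (by positivity) fun i => ?_
  rw [Fin.sum_univ_succ, hv0, norm_zero, Fin.sum_univ_castSucc (fun t => ‖w' t _‖ ^ 2)]
  have : ∀ s : Fin T, ‖v s.succ (S.node s.succ i)‖ ^ 2
      ≤ (δ * (2 * L)) ^ 2 * ‖w' s.castSucc (S.node s.castSucc i)‖ ^ 2 := by
    intro s
    rw [← mul_pow]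
    refine pow_le_pow_left₀ (norm_nonneg _) ?_ 2
    rw [hv, shift_succ, norm_smul, Real.norm_eq_abs, S.parent_node]
    have h1 := norm_dynamics_le (H.norm_A s.succ (S.node s.succ i))
      (H.norm_B s.succ (S.node s.succ i)) (w s.castSucc (S.node s.castSucc i))
    have h2 := mul_le_mul_of_nonneg_left h1 (abs_nonneg (r s))
    have h3 := mul_le_mul_of_nonneg_left (hw s (S.node s.castSucc i)) (by linarith : 0 ≤ 2 * L)
    linarith
  have hs := Finset.sum_le_sum fun s (_ : s ∈ Finset.univ) => this s
  rw [← Finset.mul_sum] at hs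
  have : 0 ≤ (δ * (2 * L)) ^ 2 * ‖w' (Fin.last T) (S.node (Fin.last T) i)‖ ^ 2 := by positivity
  linarith

/-- Apply the stabilizing feedback `u = -K x`, so that `x` follows the stable closed loop driven by
`c`. Since `K` sees only the parent node, the result is nonanticipative; `‖u‖ ≤ L ‖x‖` accounts for
the factor `1 + L` in `σ`. -/
theorem Assumption.exists_rightInverse (H : S.Assumption D val L α γ) (hL : 1 ≤ L)
    (hα : α ∈ Set.Ioo (0 : ℝ) 1) (c : S.NodeFamily (Vec nx)) :
    ∃ y, S.constraint D val y = c ∧ ‖y‖ ≤ constσ L α * ‖c‖ := by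
  obtain ⟨K, hK, hst⟩ := H.stabilizable
  let x : ∀ t, N t → Vec nx := fun t => Fin.induction (motive := fun t => N t → Vec nx) (c 0)
    (fun s x h => Matrix.toEuclideanLin (D.A (val s.succ h)
      - D.B (val s.succ h) * K s (S.parent s h)) (x (S.parent s h)) + c s.succ h) t
  have hx0 : x 0 = c 0 := rfl
  have hxs : ∀ (s : Fin T) h, x s.succ h = Matrix.toEuclideanLin (D.A (val s.succ h)
      - D.B (val s.succ h) * K s (S.parent s h)) (x s.castSucc (S.parent s h)) + c s.succ h := by
    intro s h
    simp only [x]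
    rw [Fin.induction_succ]
  -- The last control enters no constraint and has no gain, so it is set to `0`.
  let u : ∀ t, N t → Vec nu := fun t => Fin.lastCases (motive := fun t => N t → Vec nu) 0
    (fun s h => - Matrix.toEuclideanLin (K s h) (x s.castSucc h)) t
  have hul : u (Fin.last T) = 0 := Fin.lastCases_last
  have hus : ∀ (s : Fin T), u s.castSucc = fun h =>
      - Matrix.toEuclideanLin (K s h) (x s.castSucc h) := fun s => Fin.lastCases_castSucc s
  have hu : ∀ t h, ‖u t h‖ ≤ L * ‖x t h‖ := by
    intro t h
    cases t using Fin.lastCases with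
    | last => rw [hul]; simp only [Pi.zero_apply, norm_zero]; positivity
    | cast s =>
      rw [hus, norm_neg]
      exact (norm_toEuclideanLin_le _ _).trans
        (mul_le_mul_of_nonneg_right (hK s h) (norm_nonneg _))
  let y : S.NodeFamily (StateControl nx nu) := ⟨fun t h => WithLp.toLp 2 (x t h, u t h)⟩
  refine ⟨y, ?_, ?_⟩
  · refine NodeFamily.ext_node fun t h => ?_
    rw [constraint_apply]
    cases t using Fin.cases with
    | zero => rw [shift_zero, sub_zero]; rfl
    | succ s =>
      change x s.succ h - (Matrix.toEuclideanLin (D.A (val s.succ h)) (x s.castSucc (S.parent s h))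
        + Matrix.toEuclideanLin (D.B (val s.succ h)) (u s.castSucc (S.parent s h))) = c s.succ h
      rw [hxs, hus]
      simp only [map_sub, LinearMap.sub_apply, map_neg, Matrix.toLpLin_mul_same,
        LinearMap.comp_apply]
      abel
  · refine NodeFamily.norm_le_of_scenario (zero_le_one.trans (one_le_constσ hL hα)) fun i => ?_
    have hsum := sum_norm_sq_le_of_stable hL hα _ (hst i) (x := fun t => x t (S.node t i))
      (c := fun t => c t (S.node t i)) (by rw [hx0]) (fun t => by rw [hxs, S.parent_node])
    have hy : ∀ t, ‖y t (S.node t i)‖ ^ 2 ≤ (1 + L) ^ 2 * ‖x t (S.node t i)‖ ^ 2 := by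
      intro t
      have h0 : ‖y t (S.node t i)‖ ^ 2 = ‖x t (S.node t i)‖ ^ 2 + ‖u t (S.node t i)‖ ^ 2 :=
        norm_sq_eq_fst_add_snd _
      have h1 := pow_le_pow_left₀ (norm_nonneg _) (hu t (S.node t i)) 2
      rw [h0]
      nlinarith [sq_nonneg ‖x t (S.node t i)‖]
    calc ∑ t, ‖y t (S.node t i)‖ ^ 2 ≤ ∑ t, (1 + L) ^ 2 * ‖x t (S.node t i)‖ ^ 2 :=
          Finset.sum_le_sum fun t _ => hy t
      _ = (1 + L) ^ 2 * ∑ t, ‖x t (S.node t i)‖ ^ 2 := by rw [Finset.mul_sum]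
      _ ≤ (1 + L) ^ 2 * ((L / (1 - α)) ^ 2 * ∑ t, ‖c t (S.node t i)‖ ^ 2) :=
          mul_le_mul_of_nonneg_left hsum (sq_nonneg _)
      _ = _ := by rw [← mul_assoc, ← mul_pow, constσ, mul_div_assoc]

theorem norm_sq_sqrt_apply {n : ℕ} {M : Matrix (Fin n) (Fin n) ℝ} (hM : M.PosSemidef)
    (x : Vec n) : ‖Matrix.toEuclideanLin (CFC.sqrt M) x‖ ^ 2
      = ⟪Matrix.toEuclideanLin M x, x⟫_ℝ := by
  have h1 : CFC.sqrt M * CFC.sqrt M = M := CFC.sqrt_mul_sqrt_self M hM.nonneg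
  have h2 : (CFC.sqrt M).PosSemidef := Matrix.nonneg_iff_posSemidef.1 (CFC.sqrt_nonneg M)
  have h3 := Matrix.isSymmetric_toEuclideanLin_iff.2 h2.isHermitian
  conv_rhs => rw [← h1]
  rw [Matrix.toLpLin_mul_same, LinearMap.comp_apply, h3, real_inner_self_eq_norm_sq]

theorem mul_norm_sq_le_of_posSemidef_sub {n : ℕ} {M : Matrix (Fin n) (Fin n) ℝ}
    (hM : (M - γ • (1 : Matrix (Fin n) (Fin n) ℝ)).PosSemidef) (x : Vec n) :
    γ * ‖x‖ ^ 2 ≤ ⟪Matrix.toEuclideanLin M x, x⟫_ℝ := by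
  have h := norm_sq_sqrt_apply hM x
  have h2 : Matrix.toEuclideanLin (M - γ • (1 : Matrix (Fin n) (Fin n) ℝ)) x
      = Matrix.toEuclideanLin M x - γ • x := by simp
  rw [h2, inner_sub_left, real_inner_smul_left, real_inner_self_eq_norm_sq] at h
  linarith [sq_nonneg ‖Matrix.toEuclideanLin
    (CFC.sqrt (M - γ • (1 : Matrix (Fin n) (Fin n) ℝ))) x‖]

/-- On the kernel, `x` starts at zero and can be rewritten as a recursion with the stable matrices
`A - K Q^{1/2}`, driven by `K Q^{1/2} x + B u`. This forcing is controlled by the stage costs, so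
the cost controls the states even where `Q` is degenerate. -/
theorem Assumption.coercive (H : S.Assumption D val L α γ) (hL : 1 ≤ L)
    (hα : α ∈ Set.Ioo (0 : ℝ) 1) (hγ : γ ∈ Set.Ioc (0 : ℝ) 1)
    (w : S.NodeFamily (StateControl nx nu)) (hw : S.constraint D val w = 0) :
    constγG L α γ * ‖w‖ ^ 2 ≤ ⟪S.hessian D val w, w⟫_ℝ := by
  obtain ⟨K, hK, hst⟩ := H.detectable
  have hw' : ∀ t h, (w t h).fst = S.shift D val w t h := by
    intro t h
    have : S.constraint D val w t h = 0 := by rw [hw]; rfl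
    exact sub_eq_zero.1 this
  rw [NodeFamily.norm_sq, NodeFamily.inner_def, Finset.mul_sum]
  refine Finset.sum_le_sum fun i _ => ?_
  rw [mul_left_comm]
  refine mul_le_mul_of_nonneg_left ?_ (S.weight_pos i).le
  let C : ∀ t : Fin (T + 1), Matrix (Fin nx) (Fin nx) ℝ := fun t =>
    CFC.sqrt (D.Q (val t (S.node t i)))
  let x : Fin (T + 1) → Vec nx := fun t => (w t (S.node t i)).fst
  let u : Fin (T + 1) → Vec nu := fun t => (w t (S.node t i)).snd
  let e : Fin (T + 1) → ℝ := fun t => ‖Matrix.toEuclideanLin (C t) (x t)‖ ^ 2 + ‖u t‖ ^ 2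
  let c : Fin (T + 1) → Vec nx := fun t => Fin.cases (motive := fun _ => Vec nx) 0
    (fun s => Matrix.toEuclideanLin (K s (S.node s.succ i))
        (Matrix.toEuclideanLin (C s.castSucc) (x s.castSucc))
      + Matrix.toEuclideanLin (D.B (val s.succ (S.node s.succ i))) (u s.castSucc)) t
  have hx0 : x 0 = c 0 := by
    simp only [x, hw', shift_zero]; rfl
  have hxs : ∀ s : Fin T, x s.succ = Matrix.toEuclideanLin (D.A (val s.succ (S.node s.succ i))
        - K s (S.node s.succ i) * C s.castSucc) (x s.castSucc) + c s.succ := by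
    intro s
    have h1 : x s.succ = Matrix.toEuclideanLin (D.A (val s.succ (S.node s.succ i))) (x s.castSucc)
        + Matrix.toEuclideanLin (D.B (val s.succ (S.node s.succ i))) (u s.castSucc) := by
      simp only [x, u, hw', shift_succ, S.parent_node]
    rw [h1]
    simp only [c, Fin.cases_succ, map_sub, LinearMap.sub_apply, Matrix.toLpLin_mul_same,
      LinearMap.comp_apply]
    abel
  have hsum := sum_norm_sq_le_of_stable hL hα _ (hst i) hx0 hxs
  have he : ∀ t, 0 ≤ e t := fun t => by positivity
  have hc : ∑ t, ‖c t‖ ^ 2 ≤ 2 * L ^ 2 * ∑ t, e t := by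
    rw [Fin.sum_univ_succ, Fin.sum_univ_castSucc e]
    have hcs : ∀ s : Fin T, ‖c s.succ‖ ^ 2 ≤ 2 * L ^ 2 * e s.castSucc := by
      intro s
      have h1 := (norm_toEuclideanLin_le (K s (S.node s.succ i))
        (Matrix.toEuclideanLin (C s.castSucc) (x s.castSucc))).trans
          (mul_le_mul_of_nonneg_right (hK s _) (norm_nonneg _))
      have h2 := (norm_toEuclideanLin_le (D.B (val s.succ (S.node s.succ i)))
        (u s.castSucc)).trans (mul_le_mul_of_nonneg_right (H.norm_B _ _) (norm_nonneg _))
      have h3 := norm_add_le (Matrix.toEuclideanLin (K s (S.node s.succ i))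
        (Matrix.toEuclideanLin (C s.castSucc) (x s.castSucc)))
        (Matrix.toEuclideanLin (D.B (val s.succ (S.node s.succ i))) (u s.castSucc))
      have h4 : ‖c s.succ‖ ≤ L * (‖Matrix.toEuclideanLin (C s.castSucc) (x s.castSucc)‖
          + ‖u s.castSucc‖) := by
        simp only [c, Fin.cases_succ]; linarith
      refine (pow_le_pow_left₀ (norm_nonneg _) h4 2).trans ?_
      rw [mul_pow, mul_assoc, mul_left_comm]
      refine mul_le_mul_of_nonneg_left ?_ (sq_nonneg L)
      exact add_sq_le
    have hs := Finset.sum_le_sum fun s (_ : s ∈ Finset.univ) => hcs s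
    rw [← Finset.mul_sum] at hs
    have h0 : ‖c 0‖ ^ 2 = 0 := by simp [c]
    have : 0 ≤ 2 * L ^ 2 * e (Fin.last T) := mul_nonneg (by positivity) (he _)
    linarith
  -- `γ ≤ 1` lets the one factor `γ` serve both the state and the control part.
  have hq : ∀ t, γ * e t ≤ ⟪S.hessian D val w t (S.node t i), w t (S.node t i)⟫_ℝ := by
    intro t
    rw [inner_hessian_apply, ← norm_sq_sqrt_apply (H.posSemidef_Q _ _), mul_add]
    refine add_le_add ?_ (mul_norm_sq_le_of_posSemidef_sub (H.posDef_R _ _) _)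
    exact mul_le_of_le_one_left (sq_nonneg _) hγ.2
  have hn : ∑ t, ‖w t (S.node t i)‖ ^ 2 ≤ ((L / (1 - α)) ^ 2 * (2 * L ^ 2) + 1) * ∑ t, e t := by
    have h1 : ∑ t, ‖w t (S.node t i)‖ ^ 2 ≤ ∑ t, ‖x t‖ ^ 2 + ∑ t, e t := by
      rw [← Finset.sum_add_distrib]
      refine Finset.sum_le_sum fun t _ => ?_
      rw [norm_sq_eq_fst_add_snd]
      have := sq_nonneg ‖Matrix.toEuclideanLin (C t) (x t)‖
      simp only [e, x, u] at this ⊢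
      linarith
    have h2 := mul_le_mul_of_nonneg_left hc (sq_nonneg (L / (1 - α)))
    linarith
  have hconst : constγG L α γ * ((L / (1 - α)) ^ 2 * (2 * L ^ 2) + 1) ≤ γ := by
    have h1 : 0 < 1 - α := by linarith [hα.2]
    have h2 : constγG L α γ * ((L / (1 - α)) ^ 2 * (2 * L ^ 2) + 1)
        = γ * ((2 * L ^ 4 + (1 - α) ^ 2) / (2 * (1 + L) ^ 2 * L ^ 4)) := by
      rw [constγG]; field_simp
    rw [h2]
    refine mul_le_of_le_one_right hγ.1.le ?_
    rw [div_le_one (by positivity)]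
    have h3 : (1 - α) ^ 2 ≤ 1 := by nlinarith [hα.1]
    have h4 : 1 ≤ L ^ 4 := one_le_pow₀ hL
    have h5 : 4 ≤ (1 + L) ^ 2 := by nlinarith
    nlinarith
  have hg := constγG_pos hL hα hγ
  calc constγG L α γ * ∑ t, ‖w t (S.node t i)‖ ^ 2
      ≤ constγG L α γ * (((L / (1 - α)) ^ 2 * (2 * L ^ 2) + 1) * ∑ t, e t) :=
        mul_le_mul_of_nonneg_left hn hg.le
    _ ≤ γ * ∑ t, e t := by
        rw [← mul_assoc]
        exact mul_le_mul_of_nonneg_right hconst (Finset.sum_nonneg fun t _ => he t)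
    _ ≤ _ := by
        rw [Finset.mul_sum]
        exact Finset.sum_le_sum fun t _ => hq t

theorem Assumption.isSaddle (H : S.Assumption D val L α γ) (hL : 1 ≤ L)
    (hα : α ∈ Set.Ioo (0 : ℝ) 1) (hγ : γ ∈ Set.Ioc (0 : ℝ) 1) :
    IsSaddle (S.hessian D val) (S.constraint D val) L (constσ L α) (constγG L α γ) where
  bound := H.norm_hessian_le (by linarith)
  rightInv := H.exists_rightInverse hL hα
  coercive := H.coercive hL hα hγ

theorem Assumption.rms_le (H : S.Assumption D val L α γ) (hL : 1 ≤ L)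
    (hα : α ∈ Set.Ioo (0 : ℝ) 1) (hγ : γ ∈ Set.Ioc (0 : ℝ) 1)
    {w a : S.NodeFamily (StateControl nx nu)} {μ b : S.NodeFamily (Vec nx)}
    (hw : S.constraint D val w = b)
    (hμ : ∀ v, ⟪S.hessian D val w, v⟫_ℝ + ⟪μ, S.constraint D val v⟫_ℝ = ⟪a, v⟫_ℝ)
    (t : Fin (T + 1)) :
    w.rms t ≤ 2 * (constγH L α γ)⁻¹ *
      ∑ t' : Fin (T + 1), rate L α γ ^ ((t : ℤ) - (t' : ℤ)).natAbs * (a.rms t' + b.rms t') := by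
  have hρ := rate_mem hL hα hγ
  have hH := constγH_pos hL hα hγ
  set ρ := rate L α γ
  -- The weight equals `1` at the stage being estimated.
  let r : Fin (T + 1) → ℝ := fun t' => ρ ^ ((t : ℤ) - (t' : ℤ)).natAbs
  have hr : ∀ t', 0 < r t' := fun t' => pow_pos hρ.1 _
  have hδ : 0 ≤ ρ⁻¹ - 1 := sub_nonneg.2 ((one_le_inv₀ hρ.1).2 hρ.2.le)
  have hcomm : ∀ v : S.NodeFamily (StateControl nx nu),
      S.constraint D val (S.scale _ r v) - S.scale _ r (S.constraint D val v)
        = S.scale _ r (S.shift D val v) - S.shift D val (S.scale _ r v) := by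
    intro v
    simp only [constraint, LinearMap.sub_apply, state_scale, map_sub]
    abel
  have hcomm0 : ∀ (v : S.NodeFamily (StateControl nx nu)) h,
      (S.scale _ r (S.shift D val v) - S.shift D val (S.scale _ r v)) 0 h = 0 := by
    intro v h
    rw [NodeFamily.sub_apply, scale_apply, shift_zero, shift_zero, smul_zero, sub_zero]
  -- The shift moves one stage forward, so its commutator with the weights sees only the difference
  -- of consecutive weights.
  have hcomms : ∀ (v : S.NodeFamily (StateControl nx nu)) (s : Fin T) h,
      (S.scale _ r (S.shift D val v) - S.shift D val (S.scale _ r v)) s.succ h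
        = (r s.succ - r s.castSucc) • S.shift D val v s.succ h := by
    intro v s h
    rw [NodeFamily.sub_apply, scale_apply, shift_succ, shift_succ, scale_apply, WithLp.smul_fst,
      WithLp.smul_snd, map_smul, map_smul, ← smul_add, sub_smul]
  have hbound := (H.isSaddle hL hα hγ).weighted_bound hL (one_le_constσ hL hα)
    (constγG_pos hL hα hγ) (D := S.scale _ r) (D' := S.scale _ r) (ε := (ρ⁻¹ - 1) * (2 * L))
    (by positivity) (scale_isSymmetric r) (scale_isSymmetric r) (hessian_scale r)
    (fun v => by
      rw [hcomm]
      refine H.norm_le_of_succ (by linarith) hδ (hcomm0 v) (hcomms v) fun s h => ?_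
      rw [scale_apply, norm_smul, Real.norm_of_nonneg (hr _).le, ← mul_assoc, abs_sub_comm]
      exact mul_le_mul_of_nonneg_right (abs_sub_pow_natAbs_le hρ t s).1 (norm_nonneg _))
    (fun v => by
      -- The weights are positive, so the commutator can be divided by them; its size is then
      -- compared with the unweighted `v`.
      let e : S.NodeFamily (Vec nx) := ⟨fun t' h =>
        (r t')⁻¹ • (S.scale _ r (S.shift D val v) - S.shift D val (S.scale _ r v)) t' h⟩
      refine ⟨e, ?_, ?_⟩
      · rw [hcomm]
        refine NodeFamily.ext_node fun t' h => ?_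
        rw [scale_apply, smul_inv_smul₀ (hr t').ne']
      · refine H.norm_le_of_succ (by linarith) hδ (w := v)
          (r := fun s => (r s.succ)⁻¹ * (r s.succ - r s.castSucc)) ?_ ?_ ?_
        · intro h
          simp only [e]
          rw [hcomm0, smul_zero]
        · intro s h
          simp only [e]
          rw [hcomms, smul_smul]
        · intro s h
          refine mul_le_mul_of_nonneg_right ?_ (norm_nonneg _)
          rw [abs_mul, abs_inv, abs_of_pos (hr _), inv_mul_le_iff₀ (hr _), abs_sub_comm, mul_comm]
          exact (abs_sub_pow_natAbs_le hρ t s).2)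
    (saddle_const_le hL hα hγ) (weight_defect_le hL hα hγ) hw hμ
  have h1 : w.rms t = (S.scale _ r w).rms t := by
    rw [rms_scale (hr t).le]; simp [r]
  rw [h1]
  refine ((NodeFamily.rms_le_norm _ t).trans hbound).trans ?_
  refine mul_le_mul_of_nonneg_left ?_ (by positivity)
  refine (add_le_add (NodeFamily.norm_le_sum_rms _) (NodeFamily.norm_le_sum_rms _)).trans (le_of_eq ?_)
  rw [← Finset.sum_add_distrib]
  refine Finset.sum_congr rfl fun t' _ => ?_
  rw [rms_scale (hr t').le, rms_scale (hr t').le, mul_add]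

end LQ

end ScenarioTree

end StochLQ

/-! ### Reduction of the stochastic problem to its scenario tree -/

namespace StochLQ

set_option linter.unusedSectionVars false

open scoped InnerProductSpace

section Reduction

variable {Ω : Type*} [MeasurableSpace Ω] {P : Measure Ω}
  {Ξ : Type*} [MeasurableSpace Ξ] [MeasurableSingletonClass Ξ] {T : ℕ}
  {ξ : Fin (T + 1) → Ω → Ξ} {s₀ : Ξ}

theorem measurable_hist (hξ : ∀ t, Measurable (ξ t)) (t : Fin (T + 1)) :
    Measurable (hist ξ t) :=
  measurable_pi_lambda _ fun s => hξ s

theorem condLaw_ne_zero_of_mem_histSupport [IsFiniteMeasure P] (hξ : ∀ t, Measurable (ξ t))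
    {t : Fin (T + 1)} {h : Hist Ξ t} (hh : h ∈ histSupport P ξ s₀ t) :
    condLaw P ξ s₀ (hist ξ t ⁻¹' {h}) ≠ 0 := by
  have hsub : hist ξ t ⁻¹' {h} ⊆ ξ 0 ⁻¹' {s₀} := by
    rintro ω rfl
    exact hh.2
  rw [condLaw, cond_apply (hξ 0 (measurableSet_singleton s₀)), Set.inter_eq_right.2 hsub]
  exact mul_ne_zero (ENNReal.inv_ne_zero.2 (measure_ne_top _ _)) hh.1

/-- Supported histories are atoms, so an almost sure property is realized on each of them. This
turns the almost sure assumptions into statements at every node. -/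
theorem exists_hist_eq_of_ae [IsFiniteMeasure P] (hξ : ∀ t, Measurable (ξ t))
    {t : Fin (T + 1)} {h : Hist Ξ t} (hh : h ∈ histSupport P ξ s₀ t) {p : Ω → Prop}
    (hp : ∀ᵐ ω ∂(condLaw P ξ s₀), p ω) : ∃ ω, hist ξ t ω = h ∧ p ω := by
  by_contra! hcon
  refine condLaw_ne_zero_of_mem_histSupport hξ hh (measure_mono_null ?_ (ae_iff.1 hp))
  exact fun ω hω => hcon ω hω

theorem finite_histSupport (hfin : HasFiniteSupport P ξ) (t : Fin (T + 1)) :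
    (histSupport P ξ s₀ t).Finite := by
  obtain ⟨S, hS, hae⟩ := hfin
  refine (hS.image fun (x : Fin (T + 1) → Ξ) (s : Finset.Iic t) => x s).subset fun h hh => ?_
  by_contra hcon
  refine hh.1 (measure_mono_null ?_ (ae_iff.1 hae))
  intro ω hω hmem
  exact hcon ⟨_, hmem, hω⟩

theorem ae_hist_mem_histSupport (hξ : ∀ t, Measurable (ξ t)) (hfin : HasFiniteSupport P ξ)
    (t : Fin (T + 1)) : ∀ᵐ ω ∂(condLaw P ξ s₀), hist ξ t ω ∈ histSupport P ξ s₀ t := by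
  obtain ⟨S, hS, hae⟩ := hfin
  let π : (Fin (T + 1) → Ξ) → Hist Ξ t := fun x s => x s
  -- Finite support leaves only finitely many histories of probability zero to discard.
  have h1 : ∀ᵐ ω ∂P, ∀ x ∈ S, P (hist ξ t ⁻¹' {π x}) = 0 → hist ξ t ω ≠ π x := by
    rw [ae_ball_iff hS.countable]
    intro x _
    by_cases h0 : P (hist ξ t ⁻¹' {π x}) = 0
    · filter_upwards [measure_eq_zero_iff_ae_notMem.1 h0] with ω hω _ heq using hω heq
    · exact Filter.Eventually.of_forall fun ω h => absurd h h0
  have h2 : ∀ᵐ ω ∂P, P (hist ξ t ⁻¹' {hist ξ t ω}) ≠ 0 := by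
    filter_upwards [h1, hae] with ω hω hmem h0
    exact hω _ hmem h0 rfl
  filter_upwards [cond_absolutelyContinuous.ae_le h2,
    ae_cond_mem (hξ 0 (measurableSet_singleton s₀))] with ω h3 h4
  exact ⟨h3, h4⟩

theorem integral_hist_eq_sum [IsFiniteMeasure P] (hξ : ∀ t, Measurable (ξ t))
    (hfin : HasFiniteSupport P ξ) {t : Fin (T + 1)} [Fintype (histSupport P ξ s₀ t)]
    (g : Hist Ξ t → ℝ) :
    ∫ ω, g (hist ξ t ω) ∂(condLaw P ξ s₀)
      = ∑ h : histSupport P ξ s₀ t, (condLaw P ξ s₀).real (hist ξ t ⁻¹' {h.1}) * g h.1 := by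
  classical
  have : IsFiniteMeasure (condLaw P ξ s₀) := by unfold condLaw; infer_instance
  have hm : ∀ h : Hist Ξ t, MeasurableSet (hist ξ t ⁻¹' {h}) := fun h =>
    measurable_hist hξ t (measurableSet_singleton h)
  have hae : (fun ω => g (hist ξ t ω)) =ᵐ[condLaw P ξ s₀]
      fun ω => ∑ h : histSupport P ξ s₀ t, (hist ξ t ⁻¹' {h.1}).indicator (fun _ => g h.1) ω := by
    filter_upwards [ae_hist_mem_histSupport hξ hfin t] with ω hω
    rw [Finset.sum_eq_single (⟨hist ξ t ω, hω⟩ : histSupport P ξ s₀ t)]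
    · exact (Set.indicator_of_mem (s := hist ξ t ⁻¹' {hist ξ t ω}) (a := ω)
        (Set.mem_singleton _) fun _ => g (hist ξ t ω)).symm
    · intro h _ hne
      refine Set.indicator_of_notMem (fun hmem => hne (Subtype.ext ?_)) _
      exact (Set.mem_singleton_iff.1 hmem).symm
    · exact fun hn => absurd (Finset.mem_univ _) hn
  rw [integral_congr_ae hae, integral_finsetSum]
  · refine Finset.sum_congr rfl fun h _ => ?_
    rw [integral_indicator_const _ (hm _), smul_eq_mul]
  · exact fun h _ => (integrable_const _).indicator (hm _)

/-- The scenario tree of the process `ξ` given `ξ_0 = s₀`. -/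
noncomputable def scenarioTree [IsFiniteMeasure P] (hξ : ∀ t, Measurable (ξ t))
    (hfin : HasFiniteSupport P ξ) (s₀ : Ξ) [Fintype (histSupport P ξ s₀ (Fin.last T))] :
    ScenarioTree T (histSupport P ξ s₀ (Fin.last T)) (fun t => histSupport P ξ s₀ t) where
  weight i := (condLaw P ξ s₀).real (hist ξ (Fin.last T) ⁻¹' {i.1})
  weight_pos i := by
    have : IsFiniteMeasure (condLaw P ξ s₀) := by unfold condLaw; infer_instance
    exact ENNReal.toReal_pos (condLaw_ne_zero_of_mem_histSupport hξ i.2) (measure_ne_top _ _)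
  node t i := ⟨fun s => i.1 ⟨s, Finset.mem_Iic.2 (Fin.le_last _)⟩, by
    obtain ⟨ω, hω, h⟩ := exists_hist_eq_of_ae hξ i.2 (ae_hist_mem_histSupport hξ hfin t)
    rw [← hω]; exact h⟩
  node_surjective t h := by
    obtain ⟨ω, hω, hmem⟩ := exists_hist_eq_of_ae hξ h.2
      (ae_hist_mem_histSupport hξ hfin (Fin.last T))
    exact ⟨⟨_, hmem⟩, Subtype.ext hω⟩
  parent t h := ⟨h.1.init, by
    obtain ⟨ω, hω, hmem⟩ := exists_hist_eq_of_ae hξ h.2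
      (ae_hist_mem_histSupport hξ hfin t.castSucc)
    rw [← hω]; exact hmem⟩
  parent_node _ _ := rfl

section Tree

variable [IsFiniteMeasure P] (hξ : ∀ t, Measurable (ξ t)) (hfin : HasFiniteSupport P ξ)
  [Fintype (histSupport P ξ s₀ (Fin.last T))]

theorem sum_weight (hs₀ : P (ξ 0 ⁻¹' {s₀}) ≠ 0) :
    ∑ i, (scenarioTree hξ hfin s₀).weight i = 1 := by
  have h := integral_hist_eq_sum hξ hfin (s₀ := s₀) (t := Fin.last T) fun _ => 1
  have : IsProbabilityMeasure (condLaw P ξ s₀) := cond_isProbabilityMeasure hs₀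
  simp only [integral_const, probReal_univ, smul_eq_mul, mul_one] at h
  exact h.symm

/-- Expectations at every stage are taken over complete histories, so one set of weights serves all
stages. -/
theorem integral_node_eq_sum (t : Fin (T + 1)) {g : Hist Ξ t → ℝ} :
    ∫ ω, g (hist ξ t ω) ∂(condLaw P ξ s₀) = ∑ i, (scenarioTree hξ hfin s₀).weight i *
      g ((scenarioTree hξ hfin s₀).node t i).1 :=
  integral_hist_eq_sum hξ hfin (t := Fin.last T)
    fun h => g fun s => h ⟨s, Finset.mem_Iic.2 (Fin.le_last _)⟩

variable {nx nu : ℕ}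

theorem Policy.eval_coe (w : Policy P ξ s₀ nx nu) {t : Fin (T + 1)} (h : histSupport P ξ s₀ t) :
    w.eval t h.1 = w t h :=
  Subtype.val_injective.extend_apply _ _ _

theorem Policy.rms_eq (w : Policy P ξ s₀ nx nu) (t : Fin (T + 1)) :
    w.rms t = ScenarioTree.NodeFamily.rms (S := scenarioTree hξ hfin s₀) ⟨w⟩ t := by
  rw [Policy.rms, ScenarioTree.NodeFamily.rms,
    integral_node_eq_sum hξ hfin t (g := fun h => ‖w.eval t h‖ ^ 2)]
  simp only [Policy.eval_coe]

theorem rmsP_eq (D : LQData Ξ nx nu) (t : Fin (T + 1)) :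
    rmsP P ξ s₀ D t = ScenarioTree.NodeFamily.rms (S := scenarioTree hξ hfin s₀)
      ⟨fun _ h => D.p h.1.last⟩ t := by
  rw [rmsP, ScenarioTree.NodeFamily.rms, ← integral_node_eq_sum hξ hfin t
    (g := fun h => ‖D.p h.last‖ ^ 2)]
  rfl

/-- The linear part of the cost, as a process. -/
noncomputable def costVector (D : LQData Ξ nx nu) :
    (scenarioTree hξ hfin s₀).NodeFamily (StateControl nx nu) :=
  ⟨fun _ h => WithLp.toLp 2 (D.q h.1.last, D.r h.1.last)⟩

/-- The right-hand side of the dynamic constraints, as a process. -/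
noncomputable def constraintVector (D : LQData Ξ nx nu) (wInit : StateControl nx nu) :
    (scenarioTree hξ hfin s₀).NodeFamily (Vec nx) :=
  ⟨fun t => Fin.cases (motive := fun t => histSupport P ξ s₀ t → Vec nx) (fun _ => D.f wInit s₀)
    (fun _ h => D.d h.1.last) t⟩

theorem Policy.cost_eq (D : LQData Ξ nx nu) (w : Policy P ξ s₀ nx nu) :
    w.cost D = 1 / 2 * ⟪(scenarioTree hξ hfin s₀).hessian D (fun _ h => h.1.last) ⟨w⟩, ⟨w⟩⟫_ℝ
      - ⟪costVector hξ hfin D, ⟨w⟩⟫_ℝ := by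
  have h : w.cost D = ∑ i, (scenarioTree hξ hfin s₀).weight i * ∑ t,
      D.stageCost (w.eval t ((scenarioTree hξ hfin s₀).node t i).1)
        ((scenarioTree hξ hfin s₀).node t i).1.last :=
    integral_hist_eq_sum hξ hfin (t := Fin.last T) fun h => ∑ t, D.stageCost
      (w.eval t fun s => h ⟨s, Finset.mem_Iic.2 (Fin.le_last _)⟩)
      (h ⟨t, Finset.mem_Iic.2 (Fin.le_last _)⟩)
  rw [h, ScenarioTree.NodeFamily.inner_def, ScenarioTree.NodeFamily.inner_def, Finset.mul_sum,
    ← Finset.sum_sub_distrib]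
  refine Finset.sum_congr rfl fun i _ => ?_
  rw [mul_left_comm, ← mul_sub, Finset.mul_sum Finset.univ _ (1 / 2 : ℝ),
    ← Finset.sum_sub_distrib]
  congr 1
  refine Finset.sum_congr rfl fun t _ => ?_
  rw [ScenarioTree.inner_hessian_apply, Policy.eval_coe, LQData.stageCost]
  simp only [costVector]
  rw [WithLp.prod_inner_apply, real_inner_comm (Matrix.toEuclideanLin (D.Q _) _),
    real_inner_comm (Matrix.toEuclideanLin (D.R _) _)]
  rfl

theorem Policy.isFeasible_iff (D : LQData Ξ nx nu) (wInit : StateControl nx nu)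
    (w : Policy P ξ s₀ nx nu) : w.IsFeasible D wInit ↔
      (scenarioTree hξ hfin s₀).constraint D (fun _ h => h.1.last) ⟨w⟩
        = constraintVector hξ hfin D wInit := by
  have hstep : ∀ (t : Fin T) (h : histSupport P ξ s₀ t.succ),
      D.f (w.eval t.castSucc h.1.init) h.1.last =
        (scenarioTree hξ hfin s₀).shift D (fun _ h => h.1.last) ⟨w⟩ t.succ h + D.d h.1.last := by
    intro t h
    rw [ScenarioTree.shift_succ]
    exact congrArg (fun x => D.f x h.1.last)
      (w.eval_coe ((scenarioTree hξ hfin s₀).parent t h))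
  constructor
  · intro hw
    refine ScenarioTree.NodeFamily.ext_node fun t h => ?_
    rw [ScenarioTree.constraint_apply]
    cases t using Fin.cases with
    | zero =>
      rw [ScenarioTree.shift_zero, sub_zero]
      exact hw.initial h
    | succ s =>
      exact sub_eq_iff_eq_add'.2 ((hw.step s h).trans (hstep s h))
  · intro hw
    have h1 : ∀ t h, (w t h).fst - (scenarioTree hξ hfin s₀).shift D (fun _ h => h.1.last) ⟨w⟩ t h
        = constraintVector hξ hfin D wInit t h := by
      intro t h
      rw [← hw, ScenarioTree.constraint_apply]
    refine ⟨fun h => ?_, fun t h => ?_⟩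
    · have := h1 0 h
      rw [ScenarioTree.shift_zero, sub_zero] at this
      exact this
    · rw [hstep]
      exact sub_eq_iff_eq_add'.1 (h1 t.succ h)

theorem SystemAssumption.toTree {D : LQData Ξ nx nu} {L α γ : ℝ}
    (H : SystemAssumption (condLaw P ξ s₀) ξ D L α γ) :
    (scenarioTree hξ hfin s₀).Assumption D (fun _ h => h.1.last) L α γ := by
  have hb : ∀ t (h : histSupport P ξ s₀ t), ‖D.A h.1.last‖ ≤ L ∧ ‖D.B h.1.last‖ ≤ L ∧
      ‖D.Q h.1.last‖ ≤ L ∧ ‖D.R h.1.last‖ ≤ L := by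
    rintro t ⟨h, hh⟩
    obtain ⟨ω, rfl, hω⟩ := exists_hist_eq_of_ae hξ hh (H.bounded t)
    exact hω
  refine ⟨fun t h => (hb t h).1, fun t h => (hb t h).2.1, fun t h => (hb t h).2.2.1,
    fun t h => (hb t h).2.2.2, ?_, ?_, ?_, ?_⟩
  · rintro t ⟨h, hh⟩
    obtain ⟨ω, rfl, hω⟩ := exists_hist_eq_of_ae hξ hh (H.posSemidef_Q t)
    exact hω
  · rintro t ⟨h, hh⟩
    obtain ⟨ω, rfl, hω⟩ := exists_hist_eq_of_ae hξ hh (H.posDef_R t)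
    exact hω
  · obtain ⟨K, hK, hst⟩ := H.stabilizable
    refine ⟨fun t h => K t h.1, ?_, ?_⟩
    · rintro t ⟨h, hh⟩
      obtain ⟨ω, rfl, hω⟩ := exists_hist_eq_of_ae hξ hh (hK t)
      exact hω
    · rintro ⟨h, hh⟩ a b hab
      obtain ⟨ω, rfl, hω⟩ := exists_hist_eq_of_ae hξ hh (hst a b hab)
      exact hω
  · obtain ⟨K, hK, hst⟩ := H.detectable
    refine ⟨fun t h => K t h.1, ?_, ?_⟩
    · rintro t ⟨h, hh⟩
      obtain ⟨ω, rfl, hω⟩ := exists_hist_eq_of_ae hξ hh (hK t)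
      exact hω
    · rintro ⟨h, hh⟩ a b hab
      obtain ⟨ω, rfl, hω⟩ := exists_hist_eq_of_ae hξ hh (hst a b hab)
      exact hω

theorem LQData.norm_p_sq (D : LQData Ξ nx nu) (s : Ξ) :
    ‖D.p s‖ ^ 2 = ‖D.q s‖ ^ 2 + (‖D.r s‖ ^ 2 + ‖D.d s‖ ^ 2) := by
  rw [LQData.p, WithLp.prod_norm_sq_eq_of_L2, WithLp.prod_norm_sq_eq_of_L2]
  rfl

theorem LQData.norm_d_le (D : LQData Ξ nx nu) (s : Ξ) : ‖D.d s‖ ≤ ‖D.p s‖ :=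
  le_of_sq_le_sq (by
    rw [D.norm_p_sq]; nlinarith [sq_nonneg ‖D.q s‖, sq_nonneg ‖D.r s‖]) (norm_nonneg _)

theorem rms_costVector_le (D : LQData Ξ nx nu) (t : Fin (T + 1)) :
    (costVector (s₀ := s₀) hξ hfin D).rms t ≤ rmsP P ξ s₀ D t := by
  rw [rmsP_eq hξ hfin]
  refine ScenarioTree.NodeFamily.rms_le_rms fun h => le_of_sq_le_sq ?_ (norm_nonneg _)
  have h1 : ‖costVector (s₀ := s₀) hξ hfin D t h‖ ^ 2 = ‖D.q h.1.last‖ ^ 2 + ‖D.r h.1.last‖ ^ 2 :=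
    ScenarioTree.norm_sq_eq_fst_add_snd _
  rw [h1, D.norm_p_sq]
  linarith [sq_nonneg ‖D.d h.1.last‖]

theorem rms_constraintVector_succ_le (D : LQData Ξ nx nu) (wInit : StateControl nx nu)
    (t : Fin T) : (constraintVector (s₀ := s₀) hξ hfin D wInit).rms t.succ ≤ rmsP P ξ s₀ D t.succ := by
  rw [rmsP_eq hξ hfin]
  exact ScenarioTree.NodeFamily.rms_le_rms fun h => D.norm_d_le _

/-- Stage `0` is deterministic given `ξ_0 = s₀`, so both root mean squares are plain norms. The
initial condition contributes `2L ‖wInit‖` through `A` and `B`. -/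
theorem rms_constraintVector_zero_le (hs₀ : P (ξ 0 ⁻¹' {s₀}) ≠ 0) {D : LQData Ξ nx nu}
    {L α γ : ℝ} (H : SystemAssumption (condLaw P ξ s₀) ξ D L α γ) (wInit : StateControl nx nu) :
    (constraintVector (s₀ := s₀) hξ hfin D wInit).rms 0 ≤ 2 * L * ‖wInit‖ + rmsP P ξ s₀ D 0 := by
  have hsum := sum_weight hξ hfin hs₀
  have hlast : ∀ h : histSupport P ξ s₀ 0, h.1.last = s₀ := fun h => h.2.2
  have hb : (constraintVector (s₀ := s₀) hξ hfin D wInit).rms 0 = ‖D.f wInit s₀‖ := by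
    have : ∀ h : histSupport P ξ s₀ 0, constraintVector (s₀ := s₀) hξ hfin D wInit 0 h = D.f wInit s₀ :=
      fun _ => rfl
    rw [ScenarioTree.NodeFamily.rms]
    simp only [this]
    rw [← Finset.sum_mul, hsum, one_mul, Real.sqrt_sq (norm_nonneg _)]
  have hp : rmsP P ξ s₀ D 0 = ‖D.p s₀‖ := by
    rw [rmsP_eq hξ hfin, ScenarioTree.NodeFamily.rms]
    simp only [hlast]
    rw [← Finset.sum_mul, hsum, one_mul, Real.sqrt_sq (norm_nonneg _)]
  -- The bounds on `A` and `B` are known only at nodes; a scenario exists because the weights sum to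
  -- `1`, and its root carries the value `s₀`.
  obtain ⟨i, -⟩ : (Finset.univ : Finset (histSupport P ξ s₀ (Fin.last T))).Nonempty := by
    rw [Finset.nonempty_iff_ne_empty]
    intro h0
    rw [h0, Finset.sum_empty] at hsum
    exact zero_ne_one hsum
  have HT := H.toTree hξ hfin
  have hA := HT.norm_A 0 ((scenarioTree hξ hfin s₀).node 0 i)
  have hB := HT.norm_B 0 ((scenarioTree hξ hfin s₀).node 0 i)
  rw [hlast] at hA hB
  rw [hb, hp, LQData.f]
  exact (norm_add_le _ _).trans
    (add_le_add (ScenarioTree.norm_dynamics_le hA hB wInit) (D.norm_d_le s₀))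

end Tree

end Reduction

end StochLQ

/-! ### The main theorem -/

open StochLQ

theorem corollary1
    {Ω : Type*} [MeasurableSpace Ω] (P : Measure Ω) [IsProbabilityMeasure P]
    {Ξ : Type*} [MeasurableSpace Ξ] [MeasurableSingletonClass Ξ]
    {T nx nu : ℕ} (hT : 0 < T)
    (ξ : Fin (T + 1) → Ω → Ξ) (hξ : ∀ t, Measurable (ξ t))
    (hfin : StochLQ.HasFiniteSupport P ξ)
    (D : StochLQ.LQData Ξ nx nu)
    (s₀ : Ξ) (hs₀ : P (ξ 0 ⁻¹' {s₀}) ≠ 0)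
    (L α γ : ℝ) (hL : 1 ≤ L) (hα : α ∈ Set.Ioo (0 : ℝ) 1) (hγ : γ ∈ Set.Ioc (0 : ℝ) 1)
    (hsys : StochLQ.SystemAssumption (StochLQ.condLaw P ξ s₀) ξ D L α γ)
    (wInit : StochLQ.StateControl nx nu) :
    StochLQ.rate L α γ ∈ Set.Ioo (0 : ℝ) 1 ∧
    ∃ w : StochLQ.Policy P ξ s₀ nx nu,
      w.IsOptimal D wInit ∧
      (∀ w' : StochLQ.Policy P ξ s₀ nx nu, w'.IsOptimal D wInit → w' = w) ∧
      (∀ t : Fin (T + 1),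
        w.rms t ≤ StochLQ.constC L α γ *
          (2 * L * StochLQ.rate L α γ ^ (t : ℕ) * ‖wInit‖
            + ∑ t' : Fin (T + 1), StochLQ.rate L α γ ^ ((t : ℤ) - (t' : ℤ)).natAbs
                * StochLQ.rmsP P ξ s₀ D t')) ∧
      (∀ t : Fin (T + 1),
        w.rms t ≤ StochLQ.constC L α γ *
          (2 * L * StochLQ.rate L α γ ^ (t : ℕ) * ‖wInit‖
            + 2 / (1 - StochLQ.rate L α γ) * StochLQ.maxRmsP P ξ s₀ D)) := by
  have hρ := rate_mem hL hα hγ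
  have hH := constγH_pos hL hα hγ
  have hC := four_mul_inv_le_constC hL hα hγ
  refine ⟨hρ, ?_⟩
  let : Fintype (histSupport P ξ s₀ (Fin.last T)) := (finite_histSupport hfin _).fintype
  have HT := hsys.toTree hξ hfin
  have hsaddle := HT.isSaddle hL hα hγ
  have hg := constγG_pos hL hα hγ
  obtain ⟨w, μ, hw, hμ⟩ := hsaddle.exists_solution (by linarith)
    (zero_le_one.trans (one_le_constσ hL hα)) hg (costVector hξ hfin D)
    (constraintVector hξ hfin D wInit)
  obtain ⟨w, rfl⟩ : ∃ v : Policy P ξ s₀ nx nu, w = ⟨v⟩ := ⟨w.toFun, rfl⟩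
  -- Quadratic growth yields both optimality and uniqueness.
  have hgap : ∀ w' : Policy P ξ s₀ nx nu, w'.IsFeasible D wInit →
      w.cost D + constγG L α γ / 2
        * ‖(⟨w'⟩ - ⟨w⟩ : (scenarioTree hξ hfin s₀).NodeFamily (StateControl nx nu))‖ ^ 2
        ≤ w'.cost D := by
    intro w' hw'
    rw [Policy.cost_eq hξ hfin, Policy.cost_eq hξ hfin]
    exact hsaddle.cost_gap ScenarioTree.hessian_isSymmetric
      (((Policy.isFeasible_iff hξ hfin D wInit w').1 hw').trans hw.symm) hμ
  have hfeas : w.IsFeasible D wInit := (Policy.isFeasible_iff hξ hfin D wInit w).2 hw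
  have hrms0 : ∀ t, 0 ≤ rmsP P ξ s₀ D t := fun t => Real.sqrt_nonneg _
  have hbound : ∀ t : Fin (T + 1), w.rms t ≤ constC L α γ *
      (2 * L * rate L α γ ^ (t : ℕ) * ‖wInit‖
        + ∑ t' : Fin (T + 1), rate L α γ ^ ((t : ℤ) - (t' : ℤ)).natAbs * rmsP P ξ s₀ D t') := by
    intro t
    have h1 := HT.rms_le hL hα hγ hw hμ t
    rw [← Policy.rms_eq hξ hfin] at h1
    have hpow : ∀ n : ℕ, 0 ≤ rate L α γ ^ n := fun n => pow_nonneg hρ.1.le n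
    -- The vector `p` is counted twice: `q` and `r` enter the cost vector, `d` the constraint
    -- vector. With the factor `2 / γ_H` this gives the `4 / γ_H` that `c₁` dominates.
    have h2 : ∑ t' : Fin (T + 1), rate L α γ ^ ((t : ℤ) - (t' : ℤ)).natAbs
          * ((costVector (s₀ := s₀) hξ hfin D).rms t' + (constraintVector (s₀ := s₀) hξ hfin D wInit).rms t')
        ≤ 2 * L * rate L α γ ^ (t : ℕ) * ‖wInit‖
        + ∑ t' : Fin (T + 1), rate L α γ ^ ((t : ℤ) - (t' : ℤ)).natAbs
          * (2 * rmsP P ξ s₀ D t') := by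
      rw [Fin.sum_univ_succ, Fin.sum_univ_succ, ← add_assoc]
      refine add_le_add ?_ (Finset.sum_le_sum fun s _ =>
        mul_le_mul_of_nonneg_left ?_ (hpow _))
      · have h3 := rms_costVector_le (s₀ := s₀) hξ hfin D 0
        have h4 := rms_constraintVector_zero_le hξ hfin hs₀ hsys wInit
        have h5 : ((t : ℤ) - ((0 : Fin (T + 1)) : ℤ)).natAbs = (t : ℕ) := by simp
        rw [h5]
        have := mul_le_mul_of_nonneg_left (add_le_add h3 h4) (hpow t)
        linarith
      · have h3 := rms_costVector_le (s₀ := s₀) hξ hfin D s.succ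
        have h4 := rms_constraintVector_succ_le (s₀ := s₀) hξ hfin D wInit s
        linarith
    have hR : 0 ≤ ∑ t' : Fin (T + 1), rate L α γ ^ ((t : ℤ) - (t' : ℤ)).natAbs
        * rmsP P ξ s₀ D t' := Finset.sum_nonneg fun t' _ => mul_nonneg (hpow _) (hrms0 t')
    have hI : 0 ≤ 2 * L * rate L α γ ^ (t : ℕ) * ‖wInit‖ :=
      mul_nonneg (mul_nonneg (by linarith) (hpow _)) (norm_nonneg _)
    have h6 : ∑ t' : Fin (T + 1), rate L α γ ^ ((t : ℤ) - (t' : ℤ)).natAbs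
        * (2 * rmsP P ξ s₀ D t') = 2 * ∑ t' : Fin (T + 1),
          rate L α γ ^ ((t : ℤ) - (t' : ℤ)).natAbs * rmsP P ξ s₀ D t' := by
      rw [Finset.mul_sum]
      exact Finset.sum_congr rfl fun t' _ => by ring
    rw [h6] at h2
    set R := ∑ t' : Fin (T + 1), rate L α γ ^ ((t : ℤ) - (t' : ℤ)).natAbs * rmsP P ξ s₀ D t'
    set I := 2 * L * rate L α γ ^ (t : ℕ) * ‖wInit‖
    have hY : 0 ≤ 2 * (constγH L α γ)⁻¹ := by positivity
    calc w.rms t ≤ 2 * (constγH L α γ)⁻¹ * (I + 2 * R) :=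
          h1.trans (mul_le_mul_of_nonneg_left h2 hY)
      _ ≤ 2 * (constγH L α γ)⁻¹ * (2 * (I + R)) :=
          mul_le_mul_of_nonneg_left (by linarith) hY
      _ = 4 * (constγH L α γ)⁻¹ * (I + R) := by ring
      _ ≤ _ := mul_le_mul_of_nonneg_right hC (by linarith)
  refine ⟨w, ⟨hfeas, fun w' hw' => ?_⟩, fun w' hw' => ?_, hbound, fun t => ?_⟩
  · exact (le_add_of_nonneg_right (by positivity)).trans (hgap w' hw')
  · have h1 := hgap w' hw'.1
    have h2 := hw'.2 w hfeas
    have h3 : ‖(⟨w'⟩ - ⟨w⟩ : (scenarioTree hξ hfin s₀).NodeFamily (StateControl nx nu))‖ ^ 2 = 0 := by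
      refine le_antisymm ?_ (sq_nonneg _)
      refine le_of_mul_le_mul_left (a := constγG L α γ / 2) ?_ (by positivity)
      linarith
    exact congrArg ScenarioTree.NodeFamily.toFun
      (sub_eq_zero.1 (norm_eq_zero.1 ((sq_eq_zero_iff).1 h3)))
  · refine (hbound t).trans (mul_le_mul_of_nonneg_left (add_le_add le_rfl ?_)
      (le_trans (by positivity) hC))
    have hmax : ∀ t', rmsP P ξ s₀ D t' ≤ maxRmsP P ξ s₀ D := fun t' =>
      Finset.le_sup' (rmsP P ξ s₀ D) (Finset.mem_univ t')
    calc ∑ t' : Fin (T + 1), rate L α γ ^ ((t : ℤ) - (t' : ℤ)).natAbs * rmsP P ξ s₀ D t'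
        ≤ ∑ t' : Fin (T + 1), rate L α γ ^ ((t : ℤ) - (t' : ℤ)).natAbs * maxRmsP P ξ s₀ D :=
          Finset.sum_le_sum fun t' _ =>
            mul_le_mul_of_nonneg_left (hmax t') (pow_nonneg hρ.1.le _)
      _ = (∑ t' : Fin (T + 1), rate L α γ ^ ((t : ℤ) - (t' : ℤ)).natAbs)
          * maxRmsP P ξ s₀ D := by rw [Finset.sum_mul]
      _ ≤ _ := mul_le_mul_of_nonneg_right (sum_pow_natAbs_le hρ T t) ((hrms0 0).trans (hmax 0))
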